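/- Cardinals are identified with their initial ordinals. For a regular uncountable cardinal $\kappa$ and a set $A$ of ordinals let $P_\kappa A=\{x\subseteq A:|x|<\kappa\}$. A set $C\subseteq P_\kappa A$ is club if it is $\subseteq$-unbounded in $P_\kappa A$ and closed under unions of nonempty chains of size $<\kappa$; a set $S\subseteq P_\kappa A$ is stationary if it meets every club subset of $P_\kappa A$. Stationary reflection for $P_\kappa\lambda$ states that for every stationary $S\subseteq P_\kappa\lambda$ there is a set $A$ with $\kappa\subseteq A\subseteq\lambda$ and $|A|=\kappa$ such that $S\cap P_\kappa A$ is stationary in $P_\kappa A$; a stationary $S$ for which no such $A$ exists is called nonreflecting. **Theorem 1.** Let $\kappa\ge\omega_2$ be a regular cardinal and $\lambda\ge 2^{\kappa^+}$ a cardinal. Then stationary reflection for $P_\kappa\lambda$ fails. Explicitly: there are bijections $\pi_\gamma:\kappa\to\gamma$ for $\kappa\le\gamma<\kappa^+$ and a list $\{g_\xi:\xi<\lambda\}$ of all the functions $g:\kappa^+\to P_\kappa\kappa$. For every choice of these, let $h(\alpha,\beta)=\lim\bigl(\pi_\beta[\pi_\beta^{-1}(\alpha)]\bigr)$ for $\alpha<\beta$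 with $\kappa\le\beta<\kappa^+$, where $\lim B$ is the set of limit points of $B$ and the ordinal $\pi_\beta^{-1}(\alpha)<\kappa$ is regarded as a set of ordinals, and let $D$ be the set of all $x\in P_\kappa\lambda$ such that - $h(\alpha,\beta)\subseteq x$ for all $\alpha<\beta$ in $x\cap\kappa^+$ with $\beta\ge\kappa$; - $\pi_\gamma[x\cap\kappa]=x\cap\gamma$ for all $\gamma\in x$ with $\kappa\le\gamma<\kappa^+$; - $g_\xi(\gamma)\subseteq x$ for all $\xi\in x$ and $\gamma\in x\cap\kappa^+$. Then $D$ is club in $P_\kappa\lambda$, and $$S=\bigl\{x\in P_\kappa\lambda:\ \{\sup(y\cap\kappa^+):x\subseteq y\in D,\ y\cap\kappa=x\cap\kappa\}\text{ is nonstationary in }\kappa^+\bigr\}$$ is a nonreflecting stationary subset of $P_\kappa\lambda$. -/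

import Mathlib

open Cardinal Order Set

universe u

/-- `Pk κ A` is the set `P_κ A` of all subsets of `A` of cardinality `< κ`. The lift is there because
a set of ordinals of `Ordinal.{u}` lives one universe higher than `κ`. -/
def Pk (κ : Cardinal.{u}) (A : Set Ordinal.{u}) : Set (Set Ordinal.{u}) :=
  {x | x ⊆ A ∧ #x < Cardinal.lift.{u + 1} κ}

/-- `C` is club in `P_κ A`: it is a subset of `P_κ A` that is unbounded with respect to inclusion
and closed under unions of nonempty chains of size `< κ`. -/
structure IsClubPk (κ : Cardinal.{u}) (A : Set Ordinal.{u}) (C : Set (Set Ordinal.{u})) : Prop where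
  subset : C ⊆ Pk κ A
  unbounded : ∀ x ∈ Pk κ A, ∃ y ∈ C, x ⊆ y
  closed : ∀ c : Set (Set Ordinal.{u}), c ⊆ C → c.Nonempty → IsChain (· ⊆ ·) c →
    #c < Cardinal.lift.{u + 1} κ → ⋃₀ c ∈ C

/-- `S` is a stationary subset of `P_κ A`: it meets every club subset of `P_κ A`. -/
def IsStationaryPk (κ : Cardinal.{u}) (A : Set Ordinal.{u}) (S : Set (Set Ordinal.{u})) : Prop :=
  S ⊆ Pk κ A ∧ ∀ C : Set (Set Ordinal.{u}), IsClubPk κ A C → (S ∩ C).Nonempty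

/-- `S` reflects to `A`: `κ ⊆ A ⊆ l`, `|A| = κ`, and `S ∩ P_κ A` is stationary in `P_κ A`.
A cardinal is identified with the set of ordinals below its initial ordinal. -/
def ReflectsTo (κ l : Cardinal.{u}) (S : Set (Set Ordinal.{u})) (A : Set Ordinal.{u}) : Prop :=
  Iio κ.ord ⊆ A ∧ A ⊆ Iio l.ord ∧ #A = Cardinal.lift.{u + 1} κ ∧ IsStationaryPk κ A (S ∩ Pk κ A)

/-- Stationary reflection for `P_κ l`: every stationary subset of `P_κ l` reflects to some `A`. -/
def StationaryReflection (κ l : Cardinal.{u}) : Prop :=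
  ∀ S : Set (Set Ordinal.{u}), IsStationaryPk κ (Iio l.ord) S →
    ∃ A : Set Ordinal.{u}, ReflectsTo κ l S A

/-- `S` is a nonreflecting stationary subset of `P_κ l`. -/
def IsNonreflectingStationary (κ l : Cardinal.{u}) (S : Set (Set Ordinal.{u})) : Prop :=
  IsStationaryPk κ (Iio l.ord) S ∧ ¬ ∃ A : Set Ordinal.{u}, ReflectsTo κ l S A

/-- The set `lim A` of limit points of a set `A` of ordinals. -/
def limitPoints (A : Set Ordinal.{u}) : Set Ordinal.{u} :=
  {γ | 0 < γ ∧ ∀ δ < γ, ∃ α ∈ A, δ < α ∧ α < γ}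

/-- `π γ` restricts to a bijection from `κ` onto `γ` whenever `κ ≤ γ < κ⁺`. -/
def IsBijectionFamily (κ : Cardinal.{u}) (π : Ordinal.{u} → Ordinal.{u} → Ordinal.{u}) : Prop :=
  ∀ γ : Ordinal.{u}, κ.ord ≤ γ → γ < (succ κ).ord → BijOn (π γ) (Iio κ.ord) (Iio γ)

/-- `g ξ`, for `ξ < l`, lists all functions from `κ⁺` to `P_κ κ` (repetitions are allowed). -/
def IsListing (κ l : Cardinal.{u}) (g : Ordinal.{u} → Ordinal.{u} → Set Ordinal.{u}) : Prop :=
  (∀ ξ < l.ord, ∀ γ < (succ κ).ord, g ξ γ ∈ Pk κ (Iio κ.ord)) ∧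
  ∀ G : Ordinal.{u} → Set Ordinal.{u}, (∀ γ < (succ κ).ord, G γ ∈ Pk κ (Iio κ.ord)) →
    ∃ ξ < l.ord, ∀ γ < (succ κ).ord, g ξ γ = G γ

/-- `h(α, β) = lim (π_β '' π_β⁻¹(α))`, for `α < β` and `κ ≤ β < κ⁺`, where the ordinal
`η = π_β⁻¹(α) < κ` is regarded as the set of the smaller ordinals `ζ`. -/
def hSet (κ : Cardinal.{u}) (π : Ordinal.{u} → Ordinal.{u} → Ordinal.{u})
    (α β : Ordinal.{u}) : Set Ordinal.{u} :=
  limitPoints {δ | ∃ η < κ.ord, π β η = α ∧ ∃ ζ < η, π β ζ = δ}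

/-- The club set `D`. -/
def clubD (κ l : Cardinal.{u}) (π : Ordinal.{u} → Ordinal.{u} → Ordinal.{u})
    (g : Ordinal.{u} → Ordinal.{u} → Set Ordinal.{u}) : Set (Set Ordinal.{u}) :=
  {x | x ∈ Pk κ (Iio l.ord) ∧
    (∀ α ∈ x, ∀ β ∈ x, α < β → κ.ord ≤ β → β < (succ κ).ord → hSet κ π α β ⊆ x) ∧
    (∀ γ ∈ x, κ.ord ≤ γ → γ < (succ κ).ord → π γ '' (x ∩ Iio κ.ord) = x ∩ Iio γ) ∧
    (∀ ξ ∈ x, ∀ γ ∈ x, γ < (succ κ).ord → g ξ γ ⊆ x)}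

/-- The set `S` of those `x` for which the suprema of `y ∩ κ⁺`, where `y ∈ D` extends `x` and
`y ∩ κ = x ∩ κ`, form a nonstationary subset of `κ⁺`. -/
def setS (κ l : Cardinal.{u}) (π : Ordinal.{u} → Ordinal.{u} → Ordinal.{u})
    (g : Ordinal.{u} → Ordinal.{u} → Set Ordinal.{u}) : Set (Set Ordinal.{u}) :=
  {x | x ∈ Pk κ (Iio l.ord) ∧
    ¬ IsStationary {a : Iio (succ κ).ord | ∃ y ∈ clubD κ l π g, x ⊆ y ∧
      y ∩ Iio κ.ord = x ∩ Iio κ.ord ∧ (a : Ordinal.{u}) = sSup (y ∩ Iio (succ κ).ord)}}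

/-! ### Cardinality bounds below a regular cardinal; closing off under a set-valued operation. -/

section Smallness

variable {α : Type u} {K : Cardinal.{u}}

/-! Nonreflection. Let |A| = κ, enumerate A by e : κ → A, and for each η with e[η] ∈ S fix a club
C_η in κ⁺ avoiding the suprema attached to e[η]. There are only κ such clubs, so A extends to a set
A' of size κ, closed under the operations defining D, whose supremum δ below κ⁺ lies in every C_η
and is the limit of a countable sequence from A'. For club many z ∈ P_κ A, z = e[η] with η = z ∩ κ,
and z extends to some y ∈ D inside A' with the same trace on κ that contains this sequence. Then
sup(y ∩ κ⁺) = δ ∈ C_η, so z ∉ S (`not_reflectsTo_setS`).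

Stationarity. If a club C misses S, pass to the family G ⊆ C of sets closed under a finitary hull W.
No x ∈ G lies in S, so x has extensions in D with the same trace on κ reaching arbitrarily high
below κ⁺. The functions g_ξ code traces of hulls: if such an extension contains γ < κ⁺, then γ can
be added to x inside G without changing the trace (`exists_hullClosed_insert`). As κ ≥ ω₂, a chain
of length ω₁ yields a trace a in which countable subsets are bounded.

Counting gives γ < γ', each lying in some member of G with trace a, such that γ ∉ π_γ'[a]. From
these members two ω-chains in G grow with trace a, containing interleaved ordinals with common
supremum δ. Extend both unions to y, y' ∈ D with trace a reaching beyond δ. Closure under h puts δ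
into both (`mem_clubD_of_isLUB`), whence y ∩ δ = π_δ[a] = y' ∩ δ. So γ ∈ y' ∩ γ' = π_γ'[a], a
contradiction (`false_of_unbounded_extensions`). -/

theorem mk_iUnion_nat_lt (hK : K.IsRegular) (hK' : ℵ₀ < K) {f : ℕ → Set α}
    (hf : ∀ n, #(f n) < K) : #(⋃ n, f n : Set α) < K := by
  have h : (⋃ n, f n) = ⋃ n : ULift.{u} ℕ, f n.down := by
    ext; simp
  rw [h]
  exact (card_iUnion_lt_iff_forall_of_isRegular hK (by simpa using hK')).2 fun n => hf _

theorem mk_union_lt (hK : ℵ₀ ≤ K) {s t : Set α} (hs : #s < K) (ht : #t < K) :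
    #(s ∪ t : Set α) < K :=
  (mk_union_le s t).trans_lt (add_lt_of_lt hK hs ht)

theorem mk_lt_of_finite (hK : ℵ₀ ≤ K) {s : Set α} (hs : s.Finite) : #s < K :=
  (lt_aleph0_iff_set_finite.2 hs).trans_le hK

theorem mk_sep_prop_lt (hK : ℵ₀ ≤ K) {p : Prop} {s : Set α} (h : p → #s < K) :
    #{a | p ∧ a ∈ s} < K := by
  by_cases hp : p
  · simpa [hp] using h hp
  · exact mk_lt_of_finite hK (by simp [hp])

theorem mk_insert_lt (hK : ℵ₀ ≤ K) {s : Set α} (a : α) (hs : #s < K) :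
    #(insert a s : Set α) < K := by
  rw [insert_eq]
  exact mk_union_lt hK (mk_lt_of_finite hK (finite_singleton a)) hs

theorem mk_biUnion_lt {β : Type u} (hK : K.IsRegular) {s : Set α} (hs : #s < K)
    {f : α → Set β} (hf : ∀ a ∈ s, #(f a) < K) : #(⋃ a ∈ s, f a : Set β) < K :=
  (card_biUnion_lt_iff_forall_of_isRegular hK hs).2 hf

theorem mk_finset_subsets_lt (hK : ℵ₀ ≤ K) {z : Set α} (hz : #z < K) :
    #{e : Finset α | (e : Set α) ⊆ z} < K := by
  classical
  have h : #{e : Finset α | (e : Set α) ⊆ z} ≤ #(Finset z) := by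
    refine mk_le_of_surjective
      (f := fun e : Finset z => ⟨e.map (Function.Embedding.subtype _), ?_⟩) ?_
    · intro x hx
      simp only [Finset.coe_map, mem_image] at hx
      obtain ⟨y, -, rfl⟩ := hx
      exact y.2
    · rintro ⟨e, he⟩
      refine ⟨e.subtype (· ∈ z), ?_⟩
      refine Subtype.ext ?_
      exact Finset.subtype_map_of_mem fun x hx => he hx
  refine h.trans_lt ?_
  rcases finite_or_infinite z with hf | hi
  · exact (lt_aleph0_of_finite _).trans_le hK
  · rwa [mk_finset_of_infinite]

/-- Iterating an extension step `ω` times. -/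
theorem exists_seq_of_step {β : Type*} {P : β → Prop} {Q : β → β → Prop} {x : β} (hx : P x)
    (step : ∀ x, P x → ∃ y, P y ∧ Q x y) :
    ∃ f : ℕ → β, f 0 = x ∧ (∀ n, P (f n)) ∧ ∀ n, Q (f n) (f (n + 1)) := by
  choose! s hs hs' using step
  have hP : ∀ n, P (Nat.rec x (fun _ y => s y) n) := by
    intro n
    induction n with
    | zero => exact hx
    | succ n ih => exact hs _ ih
  exact ⟨fun n => Nat.rec x (fun _ y => s y) n, rfl, hP, fun n => hs' _ (hP n)⟩

/-- A set closed under the binary set-valued operation `F`. -/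
def ClosedUnder (F : α → α → Set α) (x : Set α) : Prop :=
  ∀ a ∈ x, ∀ b ∈ x, F a b ⊆ x

theorem ClosedUnder.iUnion_nat {F : α → α → Set α} {f : ℕ → Set α} (hf : Monotone f)
    (h : ∀ n, ∀ a ∈ f n, ∀ b ∈ f n, F a b ⊆ f (n + 1)) : ClosedUnder F (⋃ n, f n) := by
  intro a ha b hb
  obtain ⟨n, hn⟩ := mem_iUnion.1 ha
  obtain ⟨m, hm⟩ := mem_iUnion.1 hb
  exact (h (max n m) a (hf (le_max_left _ _) hn) b (hf (le_max_right _ _) hm)).trans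
    (subset_iUnion f _)

theorem ClosedUnder.sUnion {F : α → α → Set α} {c : Set (Set α)} (hc : IsChain (· ⊆ ·) c)
    (h : ∀ x ∈ c, ClosedUnder F x) : ClosedUnder F (⋃₀ c) := by
  rintro a ⟨x, hx, ha⟩ b ⟨y, hy, hb⟩
  obtain ⟨z, hz, hxz, hyz⟩ := hc.directedOn x hx y hy
  exact (h z hz a (hxz ha) b (hyz hb)).trans (subset_sUnion_of_mem hz)

/-- One step towards closing off under `F`. -/
def closeStep (F : α → α → Set α) (x : Set α) : Set α :=
  x ∪ ⋃ a ∈ x, ⋃ b ∈ x, F a b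

theorem subset_closeStep (F : α → α → Set α) (x : Set α) : x ⊆ closeStep F x :=
  subset_union_left

theorem apply_subset_closeStep {F : α → α → Set α} {x : Set α} {a b : α} (ha : a ∈ x)
    (hb : b ∈ x) : F a b ⊆ closeStep F x := fun _ hc =>
  Or.inr (mem_iUnion₂.2 ⟨a, ha, mem_iUnion₂.2 ⟨b, hb, hc⟩⟩)

theorem closeStep_subset {F : α → α → Set α} {A x : Set α} (hA : ClosedUnder F A) (hx : x ⊆ A) :
    closeStep F x ⊆ A :=
  union_subset hx <| iUnion₂_subset fun a ha => iUnion₂_subset fun b hb => hA a (hx ha) b (hx hb)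

theorem mk_closeStep_lt (hK : K.IsRegular) {F : α → α → Set α} {x : Set α}
    (hF : ∀ a ∈ x, ∀ b ∈ x, #(F a b) < K) (hx : #x < K) : #(closeStep F x) < K :=
  mk_union_lt hK.aleph0_le hx <| mk_biUnion_lt hK hx fun a ha =>
    mk_biUnion_lt hK hx fun b hb => hF a ha b hb

theorem exists_closedUnder (hK : K.IsRegular) (hK' : ℵ₀ < K) {F : α → α → Set α} {A x : Set α}
    (hA : ClosedUnder F A) (hF : ∀ a ∈ A, ∀ b ∈ A, #(F a b) < K) (hxA : x ⊆ A) (hx : #x < K) :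
    ∃ y, x ⊆ y ∧ y ⊆ A ∧ #y < K ∧ ClosedUnder F y := by
  obtain ⟨f, h0, hP, hQ⟩ := exists_seq_of_step
    (P := fun x : Set α => x ⊆ A ∧ #x < K) (Q := fun x y => y = closeStep F x) ⟨hxA, hx⟩
    fun x hx => ⟨_, ⟨closeStep_subset hA hx.1,
      mk_closeStep_lt hK (fun a ha b hb => hF a (hx.1 ha) b (hx.1 hb)) hx.2⟩, rfl⟩
  have hf : Monotone f := monotone_nat_of_le_succ fun n => hQ n ▸ subset_closeStep F _
  refine ⟨⋃ n, f n, h0 ▸ subset_iUnion f 0, iUnion_subset fun n => (hP n).1,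
    mk_iUnion_nat_lt hK hK' fun n => (hP n).2, ClosedUnder.iUnion_nat hf fun n a ha b hb => ?_⟩
  rw [hQ n]
  exact apply_subset_closeStep ha hb

end Smallness

/-! ### Boundedness of small sets below a regular cardinal; basic clubs in P_κ A. -/

section Bounds

variable {μ : Cardinal.{u}}

theorem exists_bound (hμ : μ.IsRegular) {s : Set Ordinal.{u}} (hs : s ⊆ Iio μ.ord)
    (hcard : #s < Cardinal.lift.{u + 1} μ) : ∃ η < μ.ord, ∀ ζ ∈ s, ζ < η := by
  have : Small.{u} s := small_subset hs
  refine ⟨⨆ i : Shrink.{u} s, Order.succ (((equivShrink s).symm i : s) : Ordinal), ?_, ?_⟩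
  · refine Ordinal.iSup_lt_of_lt_cof (hμ.cof_ord.symm ▸ ?_) fun i => ?_
    · rw [← Cardinal.lift_lt.{u, u + 1}]
      refine lt_of_le_of_lt ?_ hcard
      rw [Cardinal.lift_mk_shrink', Cardinal.lift_id'.{u, u+1}]
    · exact (Cardinal.isSuccLimit_ord hμ.aleph0_le).succ_lt (hs ((equivShrink s).symm i).2)
  · intro ζ hζ
    have := Ordinal.le_iSup (fun i : Shrink.{u} s =>
      Order.succ (((equivShrink s).symm i : s) : Ordinal)) (equivShrink s ⟨ζ, hζ⟩)
    simp only [Equiv.symm_apply_apply] at this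
    exact Order.succ_le_iff.1 this

end Bounds

theorem isClubPk_closedUnder_superset {κ : Cardinal.{u}} (hreg : κ.IsRegular) (hκ : ℵ₀ < κ)
    {F : Ordinal.{u} → Ordinal.{u} → Set Ordinal.{u}} {A B : Set Ordinal.{u}} (hB : B ∈ Pk κ A)
    (hA : ClosedUnder F A) (hF : ∀ a ∈ A, ∀ b ∈ A, #(F a b) < Cardinal.lift.{u + 1} κ) :
    IsClubPk κ A {x | x ∈ Pk κ A ∧ B ⊆ x ∧ ClosedUnder F x} where
  subset _ hx := hx.1
  unbounded x hx := by
    obtain ⟨y, hxy, hyA, hy, hyF⟩ :=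
      exists_closedUnder hreg.lift (aleph0_lt_lift.2 hκ) hA hF (union_subset hx.1 hB.1)
        (mk_union_lt (aleph0_le_lift.2 hκ.le) hx.2 hB.2)
    exact ⟨y, ⟨⟨hyA, hy⟩, subset_union_right.trans hxy, hyF⟩, subset_union_left.trans hxy⟩
  closed c hc hne hchain hcard := by
    refine ⟨⟨sUnion_subset fun x hx => (hc hx).1.1, ?_⟩, ?_,
      ClosedUnder.sUnion hchain fun x hx => (hc hx).2.2⟩
    · rw [sUnion_eq_biUnion]
      exact mk_biUnion_lt hreg.lift hcard fun x hx => (hc hx).1.2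
    · obtain ⟨x, hx⟩ := hne
      exact (hc hx).2.1.trans (subset_sUnion_of_mem hx)

theorem isClubPk_closedUnder {κ : Cardinal.{u}} (hreg : κ.IsRegular) (hκ : ℵ₀ < κ)
    {F : Ordinal.{u} → Ordinal.{u} → Set Ordinal.{u}} {A : Set Ordinal.{u}}
    (hA : ClosedUnder F A) (hF : ∀ a ∈ A, ∀ b ∈ A, #(F a b) < Cardinal.lift.{u + 1} κ) :
    IsClubPk κ A {x | x ∈ Pk κ A ∧ ClosedUnder F x} := by
  have h0 : (∅ : Set Ordinal.{u}) ∈ Pk κ A :=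
    ⟨empty_subset _, mk_lt_of_finite (aleph0_le_lift.2 hκ.le) finite_empty⟩
  simpa using isClubPk_closedUnder_superset hreg hκ h0 hA hF

theorem limitPoints_subset_Iic {B : Set Ordinal.{u}} {β : Ordinal.{u}} (hB : B ⊆ Iic β) :
    limitPoints B ⊆ Iic β := by
  intro γ hγ
  by_contra h
  obtain ⟨α, hα, hβα, -⟩ := hγ.2 β (not_le.1 h)
  exact absurd (hB hα) (not_le.2 hβα)

/-- Sending a limit point to the least element of B at or above it is injective, since an element of
B lies strictly between any two limit points up to the larger one. At most one limit point has no
element of B above it; it gets `none`. -/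
theorem mk_limitPoints_lt {K : Cardinal.{u + 1}} (hK : ℵ₀ ≤ K) {B : Set Ordinal.{u}}
    (hB : #B < K) : #(limitPoints B) < K := by
  classical
  let f : limitPoints B → Option B := fun γ =>
    if h : ∃ b ∈ B, γ.1 ≤ b then
      some ⟨sInf {b | b ∈ B ∧ γ.1 ≤ b}, (csInf_mem (s := {b | b ∈ B ∧ γ.1 ≤ b}) h).1⟩
    else none
  have key : ∀ γ γ' : limitPoints B, γ.1 < γ'.1 → f γ ≠ f γ' := by
    intro γ γ' hlt heq
    obtain ⟨b, hb, hγb, hbγ⟩ := γ'.2.2 _ hlt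
    have h : ∃ b ∈ B, γ.1 ≤ b := ⟨b, hb, hγb.le⟩
    by_cases h' : ∃ b ∈ B, γ'.1 ≤ b
    · simp only [f, dif_pos h, dif_pos h', Option.some.injEq, Subtype.mk.injEq] at heq
      have h1 : sInf {b | b ∈ B ∧ γ.1 ≤ b} ≤ b := csInf_le' ⟨hb, hγb.le⟩
      have h2 := (csInf_mem (s := {b | b ∈ B ∧ γ'.1 ≤ b}) h').2
      rw [← heq] at h2
      exact absurd (h2.trans h1) (not_le.2 hbγ)
    · simp [f, dif_pos h, dif_neg h'] at heq
  have hf : Function.Injective f := by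
    intro γ γ' heq
    rcases lt_trichotomy γ.1 γ'.1 with h | h | h
    · exact absurd heq (key _ _ h)
    · exact Subtype.ext h
    · exact absurd heq.symm (key _ _ h)
  refine (mk_le_of_injective hf).trans_lt ?_
  rw [mk_option]
  exact add_lt_of_lt hK hB (one_lt_aleph0.trans_le hK)

theorem mk_Iio_lt_lift {κ : Cardinal.{u}} {η : Ordinal.{u}} (hη : η < κ.ord) :
    #(Iio η) < Cardinal.lift.{u + 1} κ := by
  rw [mk_Iio_ordinal, Cardinal.lift_lt]
  exact lt_ord.1 hη

theorem mk_Iio_ord_eq_lift (κ : Cardinal.{u}) : #(Iio κ.ord) = Cardinal.lift.{u + 1} κ := by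
  rw [mk_Iio_ordinal, card_ord]

/-- The binary operation under which the members of `clubD` are closed. -/
def opD (κ : Cardinal.{u}) (π : Ordinal.{u} → Ordinal.{u} → Ordinal.{u})
    (g : Ordinal.{u} → Ordinal.{u} → Set Ordinal.{u}) (α β : Ordinal.{u}) : Set Ordinal.{u} :=
  {δ | (α < β ∧ κ.ord ≤ β ∧ β < (succ κ).ord) ∧ δ ∈ hSet κ π α β} ∪
  ({δ | (κ.ord ≤ β ∧ β < (succ κ).ord ∧ α < κ.ord) ∧ δ = π β α} ∪
  ({δ | (κ.ord ≤ β ∧ β < (succ κ).ord ∧ α < β) ∧ δ < κ.ord ∧ π β δ = α} ∪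
  {δ | β < (succ κ).ord ∧ δ ∈ g α β}))

/-! ### D as the club of sets closed under a single binary operation. -/

section ClubD

variable {κ l : Cardinal.{u}} {π : Ordinal.{u} → Ordinal.{u} → Ordinal.{u}}
  {g : Ordinal.{u} → Ordinal.{u} → Set Ordinal.{u}}

/-- The equation π_γ[x ∩ κ] = x ∩ γ amounts to closure under π_γ on κ and under its inverse on γ, so
all of D becomes a closure condition. -/
theorem clubD_eq (hπ : IsBijectionFamily κ π) :
    clubD κ l π g = {x | x ∈ Pk κ (Iio l.ord) ∧ ClosedUnder (opD κ π g) x} := by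
  ext x
  refine and_congr_right fun hx => ⟨?_, ?_⟩
  · rintro ⟨h1, h2, h3⟩ α hα β hβ
    rintro δ (⟨⟨h, h', h''⟩, hδ⟩ | ⟨⟨h, h', h''⟩, rfl⟩ | ⟨⟨h, h', h''⟩, hδ, hδ'⟩ | ⟨h, hδ⟩)
    · exact h1 α hα β hβ h h' h'' hδ
    · exact ((h2 β hβ h h').subset ⟨α, ⟨hα, h''⟩, rfl⟩).1
    · obtain ⟨δ', hδ₁, hδ₂⟩ := (h2 β hβ h h').superset ⟨hα, h''⟩
      rw [(hπ β h h').injOn hδ hδ₁.2 (hδ'.trans hδ₂.symm)]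
      exact hδ₁.1
    · exact h3 α hα β hβ h hδ
  · intro h
    refine ⟨fun α hα β hβ h1 h2 h3 δ hδ => h α hα β hβ (Or.inl ⟨⟨h1, h2, h3⟩, hδ⟩),
      fun γ hγ h1 h2 => Subset.antisymm ?_ ?_, fun ξ hξ γ hγ h1 δ hδ =>
        h ξ hξ γ hγ (Or.inr (Or.inr (Or.inr ⟨h1, hδ⟩)))⟩
    · rintro _ ⟨α, ⟨hα, hακ⟩, rfl⟩
      exact ⟨h α hα γ hγ (Or.inr (Or.inl ⟨⟨h1, h2, hακ⟩, rfl⟩)), (hπ γ h1 h2).mapsTo hακ⟩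
    · rintro α ⟨hα, hαγ⟩
      obtain ⟨δ, hδ, rfl⟩ := (hπ γ h1 h2).surjOn hαγ
      exact ⟨δ, ⟨h _ hα γ hγ (Or.inr (Or.inr (Or.inl ⟨⟨h1, h2, hαγ⟩, hδ, rfl⟩))), hδ⟩, rfl⟩

theorem hSet_subset (hπ : IsBijectionFamily κ π) {α β : Ordinal.{u}} (h : κ.ord ≤ β)
    (h' : β < (succ κ).ord) : hSet κ π α β ⊆ Iic β := by
  refine limitPoints_subset_Iic ?_
  rintro _ ⟨η, hη, -, ζ, hζ, rfl⟩
  exact le_of_lt (mem_Iio.1 ((hπ β h h').mapsTo (hζ.trans hη)))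

theorem mk_hSet_lt (hκ : ℵ₀ ≤ κ) (hπ : IsBijectionFamily κ π) {α β : Ordinal.{u}}
    (h : κ.ord ≤ β) (h' : β < (succ κ).ord) :
    #(hSet κ π α β) < Cardinal.lift.{u + 1} κ := by
  refine mk_limitPoints_lt (aleph0_le_lift.2 hκ) ?_
  by_cases hα : ∃ η < κ.ord, π β η = α
  · obtain ⟨η, hη, rfl⟩ := hα
    refine (mk_le_mk_of_subset (t := π β '' Iio η) ?_).trans_lt (mk_image_le.trans_lt (mk_Iio_lt_lift hη))
    rintro _ ⟨η', hη', he, ζ, hζ, rfl⟩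
    rw [(hπ β h h').injOn hη' hη he] at hζ
    exact ⟨ζ, hζ, rfl⟩
  · refine mk_lt_of_finite (aleph0_le_lift.2 hκ) ?_
    convert finite_empty
    rw [eq_empty_iff_forall_notMem]
    rintro _ ⟨η, hη, he, -⟩
    exact hα ⟨η, hη, he⟩

theorem closedUnder_opD_Iio (hl : succ κ ≤ l) (hπ : IsBijectionFamily κ π)
    (hg : IsListing κ l g) : ClosedUnder (opD κ π g) (Iio l.ord) := by
  have hl' : (succ κ).ord ≤ l.ord := ord_le_ord.2 hl
  have hκl : κ.ord ≤ l.ord := ord_le_ord.2 ((le_succ κ).trans hl)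
  intro α hα β hβ
  rintro δ (⟨⟨h, h', h''⟩, hδ⟩ | ⟨⟨h, h', h''⟩, rfl⟩ | ⟨⟨h, h', h''⟩, hδ, hδ'⟩ | ⟨h, hδ⟩)
  · exact lt_of_le_of_lt (mem_Iic.1 (hSet_subset hπ h' h'' hδ)) (mem_Iio.1 hβ)
  · exact lt_trans (mem_Iio.1 ((hπ β h h').mapsTo h'')) (mem_Iio.1 hβ)
  · exact hδ.trans_le hκl
  · exact ((hg.1 α hα β h).1 hδ).trans_le hκl

theorem mk_opD_lt (hκ : ℵ₀ ≤ κ) (hπ : IsBijectionFamily κ π) (hg : IsListing κ l g)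
    {α β : Ordinal.{u}} (hα : α < l.ord) : #(opD κ π g α β) < Cardinal.lift.{u + 1} κ := by
  have hK : ℵ₀ ≤ Cardinal.lift.{u + 1} κ := aleph0_le_lift.2 hκ
  refine mk_union_lt hK (mk_sep_prop_lt hK fun h => mk_hSet_lt hκ hπ h.2.1 h.2.2)
    (mk_union_lt hK (mk_sep_prop_lt hK (s := {π β α}) fun _ => mk_lt_of_finite hK (finite_singleton _))
    (mk_union_lt hK (mk_sep_prop_lt hK (s := {δ | δ < κ.ord ∧ π β δ = α}) fun h => mk_lt_of_finite hK ?_)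
      (mk_sep_prop_lt hK fun h => (hg.1 α hα β h).2)))
  exact Set.Subsingleton.finite fun a ha b hb =>
    (hπ β h.1 h.2.1).injOn ha.1 hb.1 (ha.2.trans hb.2.symm)

theorem isClubPk_clubD_inter (hreg : κ.IsRegular) (hκ : ℵ₀ < κ) (hπ : IsBijectionFamily κ π)
    (hg : IsListing κ l g) {A : Set Ordinal.{u}} (hAl : A ⊆ Iio l.ord)
    (hA : ClosedUnder (opD κ π g) A) : IsClubPk κ A (clubD κ l π g ∩ Pk κ A) := by
  convert isClubPk_closedUnder hreg hκ hA fun a ha b _ => mk_opD_lt hκ.le hπ hg (hAl ha) using 1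
  rw [clubD_eq hπ]
  ext x
  exact ⟨fun h => ⟨h.2, h.1.2⟩, fun h => ⟨⟨⟨h.1.1.trans hAl, h.1.2⟩, h.2⟩, h.1⟩⟩

theorem isClubPk_clubD (hreg : κ.IsRegular) (hκ : ℵ₀ < κ) (hl : succ κ ≤ l)
    (hπ : IsBijectionFamily κ π) (hg : IsListing κ l g) :
    IsClubPk κ (Iio l.ord) (clubD κ l π g) := by
  convert isClubPk_clubD_inter hreg hκ hπ hg Subset.rfl (closedUnder_opD_Iio hl hπ hg) using 1
  exact (inter_eq_left.2 fun x hx => hx.1).symm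

end ClubD

/-! ### Existence of the bijections and of the listing. -/

theorem exists_bijOn_of_mk_eq {s t : Set Ordinal.{u}} (h : #s = #t) :
    ∃ f : Ordinal.{u} → Ordinal.{u}, BijOn f s t := by
  classical
  obtain ⟨e⟩ := Cardinal.eq.1 h
  refine ⟨fun x => if hx : x ∈ s then e ⟨x, hx⟩ else 0,
    fun x hx => ?_, fun x hx y hy hxy => ?_, fun y hy => ?_⟩
  · simp only [dif_pos hx]
    exact (e ⟨x, hx⟩).2
  · simpa only [dif_pos hx, dif_pos hy, ← Subtype.ext_iff, e.injective.eq_iff,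
      Subtype.mk.injEq] using hxy
  · refine ⟨e.symm ⟨y, hy⟩, (e.symm ⟨y, hy⟩).2, ?_⟩
    simp only [dif_pos (e.symm ⟨y, hy⟩).2, Subtype.coe_eta, Equiv.apply_symm_apply]

theorem exists_isBijectionFamily (κ : Cardinal.{u}) :
    ∃ π : Ordinal.{u} → Ordinal.{u} → Ordinal.{u}, IsBijectionFamily κ π := by
  have h : ∀ γ : Ordinal.{u}, ∃ f : Ordinal.{u} → Ordinal.{u}, κ.ord ≤ γ → γ < (succ κ).ord →
      BijOn f (Iio κ.ord) (Iio γ) := by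
    intro γ
    by_cases h : κ.ord ≤ γ ∧ γ < (succ κ).ord
    · have hc : #(Iio κ.ord) = #(Iio γ) := by
        rw [mk_Iio_ordinal, mk_Iio_ordinal, card_ord, Cardinal.lift_inj]
        exact le_antisymm (ord_le.1 h.1) (lt_succ_iff.1 (lt_ord.1 h.2))
      obtain ⟨f, hf⟩ := exists_bijOn_of_mk_eq hc
      exact ⟨f, fun _ _ => hf⟩
    · exact ⟨id, fun h1 h2 => absurd ⟨h1, h2⟩ h⟩
  choose π hπ using h
  exact ⟨π, hπ⟩

/-- There are at most (2^κ)^(κ⁺) = 2^(κ⁺) functions to list. The full bound on l serves only here;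
elsewhere κ⁺ ≤ l is enough. -/
theorem exists_isListing {κ l : Cardinal.{u}} (hκ : ℵ₀ ≤ κ) (hl : 2 ^ succ κ ≤ l) :
    ∃ g : Ordinal.{u} → Ordinal.{u} → Set Ordinal.{u}, IsListing κ l g := by
  classical
  let T := Iio (succ κ).ord → Pk κ (Iio κ.ord)
  have hT : #T ≤ #(Iio l.ord) := by
    have h1 : #(Pk κ (Iio κ.ord)) ≤ 2 ^ Cardinal.lift.{u + 1} κ := by
      rw [← mk_Iio_ord_eq_lift, ← mk_powerset]
      exact mk_le_mk_of_subset fun x hx => hx.1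
    calc #T = #(Pk κ (Iio κ.ord)) ^ #(Iio (succ κ).ord) := by rw [← Cardinal.power_def]
      _ ≤ (2 ^ Cardinal.lift.{u + 1} κ) ^ #(Iio (succ κ).ord) := Cardinal.power_le_power_right h1
      _ = Cardinal.lift.{u + 1} (2 ^ succ κ) := by
        rw [mk_Iio_ord_eq_lift, ← power_mul, ← lift_mul, mul_eq_right (hκ.trans (le_succ κ)) (le_succ κ)
          (ne_of_gt (aleph0_pos.trans_le hκ)), lift_power, lift_two]
      _ ≤ #(Iio l.ord) := by rw [mk_Iio_ord_eq_lift]; exact Cardinal.lift_le.2 hl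
  obtain ⟨i⟩ := Cardinal.le_def _ _ |>.1 hT
  have h0 : (∅ : Set Ordinal.{u}) ∈ Pk κ (Iio κ.ord) :=
    ⟨empty_subset _, mk_lt_of_finite (aleph0_le_lift.2 hκ) finite_empty⟩
  have : Nonempty T := ⟨fun _ => ⟨∅, h0⟩⟩
  let j : Iio l.ord → T := Function.invFun i
  have hj : Function.Surjective j := Function.invFun_surjective i.injective
  let g : Ordinal.{u} → Ordinal.{u} → Set Ordinal.{u} := fun ξ γ =>
    if h : ξ < l.ord ∧ γ < (succ κ).ord then (j ⟨ξ, h.1⟩ ⟨γ, h.2⟩ : Set Ordinal.{u}) else ∅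
  refine ⟨g, fun ξ hξ γ hγ => ?_, fun G hG => ?_⟩
  · simp only [g, dif_pos (And.intro hξ hγ)]
    exact (j ⟨ξ, hξ⟩ ⟨γ, hγ⟩).2
  · obtain ⟨ξ, hξ⟩ := hj fun γ => ⟨G γ, hG γ γ.2⟩
    refine ⟨ξ, ξ.2, fun γ hγ => ?_⟩
    have h : (ξ : Ordinal) < l.ord ∧ γ < (succ κ).ord := ⟨ξ.2, hγ⟩
    simp only [g, dif_pos h, hξ]

/-! ### S does not reflect. -/

section Nonreflecting

variable {κ l : Cardinal.{u}} {π : Ordinal.{u} → Ordinal.{u} → Ordinal.{u}}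
  {g : Ordinal.{u} → Ordinal.{u} → Set Ordinal.{u}}

theorem mk_injOn_preimage_lt {K : Cardinal.{u}} {α : Type u} {f : α → α} {s t : Set α}
    (hf : InjOn f s) (ht : #t < K) : #{a | a ∈ s ∧ f a ∈ t} < K := by
  refine (mk_le_of_injective (f := fun a : {a | a ∈ s ∧ f a ∈ t} => (⟨f a, a.2.2⟩ : t)) ?_).trans_lt ht
  intro a b hab
  exact Subtype.ext (hf a.2.1 b.2.1 (Subtype.mk.inj hab))

/-- A set of size at most `κ` extends to one that is closed under `opD` and whose supremum below
`κ⁺` lies in `κ` many given clubs and has countable cofinality. -/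
theorem exists_closedUnder_opD_sup_mem_clubs (hκ : ℵ₀ < κ) (hl : succ κ ≤ l)
    (hπ : IsBijectionFamily κ π) (hg : IsListing κ l g) {A : Set Ordinal.{u}}
    (hAl : A ⊆ Iio l.ord) (hA : #A = Cardinal.lift.{u + 1} κ)
    {C : Ordinal.{u} → Set (Iio (succ κ).ord)} (hC : ∀ η, IsClub (C η)) :
    ∃ A' : Set Ordinal.{u}, A ⊆ A' ∧ A' ⊆ Iio l.ord ∧ #A' = Cardinal.lift.{u + 1} κ ∧
      ClosedUnder (opD κ π g) A' ∧
      ∃ (d : ℕ → Ordinal.{u}) (δ : Iio (succ κ).ord), (∀ n, d n ∈ A' ∧ d n < (succ κ).ord) ∧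
        (∀ ζ ∈ A', ζ < (succ κ).ord → ∃ n, ζ < d n) ∧ (∀ n, d n ≤ δ) ∧
        (∀ ε : Ordinal.{u}, (∀ n, d n ≤ ε) → (δ : Ordinal.{u}) ≤ ε) ∧
        ∀ η < κ.ord, δ ∈ C η := by
  have hreg' : (succ κ).IsRegular := isRegular_succ hκ.le
  have hK : (Cardinal.lift.{u + 1} (succ κ)).IsRegular := hreg'.lift
  have hK' : ℵ₀ < Cardinal.lift.{u + 1} (succ κ) := aleph0_lt_lift.2 (hκ.trans (lt_succ κ))
  have hlt : Cardinal.lift.{u + 1} κ < Cardinal.lift.{u + 1} (succ κ) :=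
    Cardinal.lift_lt.2 (lt_succ κ)
  have hMl : (succ κ).ord ≤ l.ord := ord_le_ord.2 hl
  have hcl := closedUnder_opD_Iio hl hπ hg
  obtain ⟨B, hB0, hP, hQ⟩ := exists_seq_of_step
    (P := fun B : Set Ordinal.{u} => B ⊆ Iio l.ord ∧ #B < Cardinal.lift.{u + 1} (succ κ))
    (Q := fun B B' => closeStep (opD κ π g) B ⊆ B' ∧
      (∃ δ ∈ B', δ < (succ κ).ord ∧ ∀ ζ ∈ B, ζ < (succ κ).ord → ζ < δ) ∧
      ∀ η < κ.ord, ∃ c ∈ C η, (c : Ordinal.{u}) ∈ B' ∧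
        ∀ ζ ∈ B, ζ < (succ κ).ord → ζ < c) ⟨hAl, hA ▸ hlt⟩ (by
    rintro B ⟨hB, hBc⟩
    obtain ⟨δ, hδ, hδB⟩ := exists_bound hreg' (s := B ∩ Iio (succ κ).ord) inter_subset_right
      ((mk_le_mk_of_subset inter_subset_left).trans_lt hBc)
    choose c hc hδc using fun η => (hC η).isCofinal ⟨δ, hδ⟩
    -- Each step adds a bound `δ` for the part below κ⁺ and, from each of the κ clubs, a point `c η`
    -- at or above it; the size stays at most κ.
    refine ⟨closeStep (opD κ π g) B ∪ insert δ ((fun η => (c η : Ordinal.{u})) '' Iio κ.ord),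
      ⟨union_subset (closeStep_subset hcl hB) (insert_subset (lt_of_lt_of_le hδ hMl) ?_), ?_⟩,
      subset_union_left, ⟨δ, Or.inr (mem_insert _ _), hδ, fun ζ h h' => hδB ζ ⟨h, h'⟩⟩,
      fun η hη => ⟨c η, hc η, Or.inr (mem_insert_of_mem _ ⟨η, hη, rfl⟩),
        fun ζ h h' => (hδB ζ ⟨h, h'⟩).trans_le (hδc η)⟩⟩
    · rintro _ ⟨η, -, rfl⟩
      exact lt_of_lt_of_le (c η).2 hMl
    · refine mk_union_lt hK.aleph0_le (mk_closeStep_lt hK (fun a ha b _ =>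
        (mk_opD_lt hκ.le hπ hg (hB ha)).trans hlt) hBc) (mk_insert_lt hK.aleph0_le _ ?_)
      exact mk_image_le.trans_lt (mk_Iio_ord_eq_lift κ ▸ hlt))
  have hBm : Monotone B :=
    monotone_nat_of_le_succ fun n => (subset_closeStep _ _).trans (hQ n).1
  choose d hdB hd hdlt using fun n => (hQ n).2.1
  have hcard : #(⋃ n, B n : Set Ordinal.{u}) < Cardinal.lift.{u + 1} (succ κ) :=
    mk_iUnion_nat_lt hK hK' fun n => (hP n).2
  have hdd : range d ⊆ Iio (succ κ).ord := by
    rintro _ ⟨n, rfl⟩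
    exact hd n
  have hdA : ∀ n, d n ∈ ⋃ n, B n := fun n => mem_iUnion.2 ⟨n + 1, hdB n⟩
  obtain ⟨ρ, hρ, hdρ⟩ := exists_bound hreg' hdd
    ((mk_le_mk_of_subset (range_subset_iff.2 hdA)).trans_lt hcard)
  have hbdd : BddAbove (range d) := ⟨ρ, fun a ha => (hdρ a ha).le⟩
  have hδ : sSup (range d) < (succ κ).ord :=
    (csSup_le (range_nonempty d) fun a ha => (hdρ a ha).le).trans_lt hρ
  have hlub : ∀ ε : Ordinal.{u}, (∀ n, d n ≤ ε) → sSup (range d) ≤ ε := fun ε h =>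
    csSup_le (range_nonempty d) (forall_mem_range.2 h)
  refine ⟨⋃ n, B n, hB0 ▸ subset_iUnion B 0, iUnion_subset fun n => (hP n).1,
    le_antisymm ?_ ?_, ClosedUnder.iUnion_nat hBm fun n a ha b hb =>
      (apply_subset_closeStep ha hb).trans (hQ n).1, d, ⟨sSup (range d), hδ⟩,
    fun n => ⟨hdA n, hd n⟩, fun ζ hζ hζM => ?_, fun n => le_csSup hbdd ⟨n, rfl⟩, hlub,
    fun η hη => ?_⟩
  · rwa [lift_succ, lt_succ_iff] at hcard
  · rw [← hA, ← hB0]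
    exact mk_le_mk_of_subset (subset_iUnion B 0)
  · obtain ⟨n, hn⟩ := mem_iUnion.1 hζ
    exact ⟨n, hdlt n ζ hn hζM⟩
  -- The chosen points of `C η` interleave with the `d n`, so they have the same supremum.
  · choose c hcC hcB hclt using fun n => (hQ n).2.2 η hη
    refine (hC η).isLUB_mem (t := range c) (range_subset_iff.2 hcC) (range_nonempty c) ⟨?_, ?_⟩
    · rintro _ ⟨n, rfl⟩
      exact (hdlt (n + 1) _ (hcB n) (c n).2).le.trans (le_csSup hbdd ⟨n + 1, rfl⟩)
    · intro b hb
      refine hlub _ fun n => ?_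
      exact (hclt (n + 1) _ (hdB n) (hd n)).le.trans (hb ⟨n + 1, rfl⟩)

/-- The operation witnessing that club many `z` in `P_κ A` are both initial segments of the
enumeration `e` of `A` and traces of members of `clubD` taken from the enumeration `f`. -/
def opTrace (κ : Cardinal.{u}) (A : Set Ordinal.{u}) (e f : Ordinal.{u} → Ordinal.{u})
    (d : ℕ → Ordinal.{u}) (F : Ordinal.{u} → Ordinal.{u} → Set Ordinal.{u})
    (a b : Ordinal.{u}) : Set Ordinal.{u} :=
  {ε | a < κ.ord ∧ ε ∈ (Iio a ∪ {e a, f a}) ∩ A} ∪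
  ({ε | ε ∈ Iio κ.ord ∧ e ε ∈ ({a} : Set Ordinal.{u})} ∪
  {ε | ε ∈ Iio κ.ord ∧ f ε ∈ insert a (range d ∪
    {δ | (a < κ.ord ∧ b < κ.ord) ∧ δ ∈ F (f a) (f b)})})

/-- Closure under `opTrace` makes z ∩ κ an ordinal η with z = e[η], and makes y = f[z ∩ κ] a member
of D that contains z and all `d n` and has the same trace on κ. Thus sup(y ∩ κ⁺) is the point δ
common to all the clubs. -/
theorem not_reflectsTo_setS (hreg : κ.IsRegular) (hκ : ℵ₀ < κ) (hl : succ κ ≤ l)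
    (hπ : IsBijectionFamily κ π) (hg : IsListing κ l g) (A : Set Ordinal.{u}) :
    ¬ ReflectsTo κ l (setS κ l π g) A := by
  rintro ⟨hκA, hAl, hcA, -, hstat⟩
  have hK : ℵ₀ ≤ Cardinal.lift.{u + 1} κ := aleph0_le_lift.2 hκ.le
  obtain ⟨e, he⟩ := exists_bijOn_of_mk_eq ((mk_Iio_ord_eq_lift κ).trans hcA.symm)
  have hC : ∀ η : Ordinal.{u}, ∃ C : Set (Iio (succ κ).ord), IsClub C ∧
      (e '' Iio η ∈ setS κ l π g → Disjoint {a : Iio (succ κ).ord | ∃ y ∈ clubD κ l π g,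
        e '' Iio η ⊆ y ∧ y ∩ Iio κ.ord = e '' Iio η ∩ Iio κ.ord ∧
        (a : Ordinal.{u}) = sSup (y ∩ Iio (succ κ).ord)} C) := by
    intro η
    by_cases h : e '' Iio η ∈ setS κ l π g
    · obtain ⟨C, hC, hd⟩ := not_isStationary_iff.1 h.2
      exact ⟨C, hC, fun _ => hd⟩
    -- Where e[η] ∉ S nothing has to be avoided, so any club will do.
    · exact ⟨univ, IsClub.univ, fun h' => absurd h' h⟩
  choose C hC hdisj using hC
  obtain ⟨A', hAA', hA'l, hcA', hclA', d, δ, hdA', hdcof, hdle, hlub, hδC⟩ :=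
    exists_closedUnder_opD_sup_mem_clubs hκ hl hπ hg hAl hcA hC
  obtain ⟨f, hf⟩ := exists_bijOn_of_mk_eq ((mk_Iio_ord_eq_lift κ).trans hcA'.symm)
  have h0 : (0 : Ordinal.{u}) < κ.ord := hreg.ord_pos
  -- Requiring 0 ∈ x makes x nonempty, so that closure has an argument from which to produce the
  -- preimages of the `d n`.
  have hclub : IsClubPk κ A {x | x ∈ Pk κ A ∧ {0} ⊆ x ∧
      ClosedUnder (opTrace κ A e f d (opD κ π g)) x} := by
    refine isClubPk_closedUnder_superset hreg hκ
      ⟨singleton_subset_iff.2 (hκA h0), mk_lt_of_finite hK (finite_singleton _)⟩ ?_ ?_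
    · rintro a - b - ε (h | h | h)
      · exact h.2.2
      · exact hκA h.1
      · exact hκA h.1
    · intro a _ b _
      refine mk_union_lt hK (mk_sep_prop_lt hK fun h => ?_) (mk_union_lt hK
        (mk_injOn_preimage_lt he.injOn (mk_lt_of_finite hK (finite_singleton _)))
        (mk_injOn_preimage_lt hf.injOn (mk_insert_lt hK _ (mk_union_lt hK ?_
          (mk_sep_prop_lt hK fun h => mk_opD_lt hκ.le hπ hg (hA'l (hf.mapsTo h.1)))))))
      · exact (mk_le_mk_of_subset inter_subset_left).trans_lt
          (mk_union_lt hK (mk_Iio_lt_lift h) (mk_lt_of_finite hK (toFinite _)))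
      · exact (le_aleph0_iff_set_countable.2 (countable_range d)).trans_lt (aleph0_lt_lift.2 hκ)
  obtain ⟨z, ⟨hzS, -⟩, ⟨hzA, hzc⟩, h0z, hzcl⟩ := hstat _ hclub
  rw [singleton_subset_iff] at h0z
  obtain ⟨y, hy⟩ : ∃ y, y = f '' (z ∩ Iio κ.ord) := ⟨_, rfl⟩
  have hfz : ∀ a ∈ A', ∀ b ∈ z, ∀ b' ∈ z, a ∈ insert b (range d ∪
      {δ | (b < κ.ord ∧ b' < κ.ord) ∧ δ ∈ opD κ π g (f b) (f b')}) → a ∈ y := by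
    intro a ha b hb b' hb' h
    obtain ⟨ε, hε, rfl⟩ := hf.surjOn ha
    rw [hy]
    exact ⟨ε, ⟨hzcl b hb b' hb' (Or.inr (Or.inr ⟨hε, h⟩)), hε⟩, rfl⟩
  have hyA' : y ⊆ A' := by
    rw [hy]
    rintro _ ⟨a, ⟨-, ha⟩, rfl⟩
    exact hf.mapsTo ha
  have hzy : z ⊆ y := fun a ha =>
    hfz a (hAA' (hzA ha)) a ha a ha (mem_insert _ _)
  have hyD : y ∈ clubD κ l π g := by
    rw [clubD_eq hπ]
    refine ⟨⟨hyA'.trans hA'l, ?_⟩, fun a ha b hb c hc => ?_⟩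
    · rw [hy]
      exact (mk_image_le.trans (mk_le_mk_of_subset inter_subset_left)).trans_lt hzc
    · have hcA' := hclA' a (hyA' ha) b (hyA' hb) hc
      rw [hy] at ha hb
      obtain ⟨a, ha, rfl⟩ := ha
      obtain ⟨b, hb, rfl⟩ := hb
      exact hfz c hcA' a ha.1 b hb.1 (Or.inr (Or.inr ⟨⟨ha.2, hb.2⟩, hc⟩))
  have hyκ : y ∩ Iio κ.ord = z ∩ Iio κ.ord := by
    refine Subset.antisymm ?_ (inter_subset_inter_left _ hzy)
    rintro a ⟨ha, haκ⟩
    refine ⟨?_, haκ⟩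
    rw [hy] at ha
    obtain ⟨ε, hε, rfl⟩ := ha
    exact hzcl ε hε.1 ε hε.1 (Or.inl ⟨hε.2, Or.inr (by simp), hκA haκ⟩)
  have hdy : ∀ n, d n ∈ y := fun n =>
    hfz _ (hdA' n).1 0 h0z 0 h0z (Or.inr (Or.inl ⟨n, rfl⟩))
  obtain ⟨ρ, hρ, hzρ⟩ := exists_bound hreg (s := z ∩ Iio κ.ord) inter_subset_right
    ((mk_le_mk_of_subset inter_subset_left).trans_lt hzc)
  have hne : {η : Ordinal.{u} | η ∉ z}.Nonempty := ⟨ρ, fun h => (hzρ ρ ⟨h, hρ⟩).false⟩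
  -- The least ordinal missing from z; since z ∩ κ is downward closed, it equals this ordinal.
  obtain ⟨η, hη⟩ : ∃ η, η = sInf {η : Ordinal.{u} | η ∉ z} := ⟨_, rfl⟩
  have hηz : η ∉ z := hη ▸ csInf_mem hne
  have hηκ : η < κ.ord :=
    (hη ▸ csInf_le' (show ρ ∈ {η : Ordinal.{u} | η ∉ z} from
      fun h => (hzρ ρ ⟨h, hρ⟩).false)).trans_lt hρ
  have hzη : z ∩ Iio κ.ord = Iio η := by
    ext a
    refine ⟨fun ⟨ha, haκ⟩ => ?_, fun ha => ⟨?_, lt_trans (mem_Iio.1 ha) hηκ⟩⟩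
    · by_contra h
      rcases (not_lt.1 (show ¬ a < η from h)).eq_or_lt with rfl | h
      · exact hηz ha
      · exact hηz (hzcl a ha a ha (Or.inl ⟨haκ, Or.inl h, hκA hηκ⟩))
    · by_contra h
      rw [hη] at ha
      exact absurd (csInf_le' (show a ∈ {η : Ordinal.{u} | η ∉ z} from h)) (not_le.2 ha)
  have hze : z = e '' Iio η := by
    rw [← hzη]
    ext a
    constructor
    · intro ha
      obtain ⟨ε, hε, rfl⟩ := he.surjOn (hzA ha)
      exact ⟨ε, ⟨hzcl _ ha _ ha (Or.inr (Or.inl ⟨hε, rfl⟩)), hε⟩, rfl⟩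
    · rintro ⟨ε, ⟨hε, hεκ⟩, rfl⟩
      exact hzcl ε hε ε hε (Or.inl ⟨hεκ, Or.inr (by simp), he.mapsTo hεκ⟩)
  refine disjoint_left.1 (hdisj η (hze ▸ hzS)) ?_ (hδC η hηκ)
  rw [← hze]
  refine ⟨y, hyD, hzy, hyκ, Eq.symm (csSup_eq_of_forall_le_of_forall_lt_exists_gt ?_ ?_ ?_)⟩
  · exact ⟨d 0, hdy 0, (hdA' 0).2⟩
  · rintro a ⟨ha, haM⟩
    obtain ⟨n, hn⟩ := hdcof a (hyA' ha) haM
    exact hn.le.trans (hdle n)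
  · intro w hw
    by_contra! h
    exact absurd (hlub w fun n => h _ ⟨hdy n, (hdA' n).2⟩) (not_le.2 hw)

end Nonreflecting

/-- Every infinite type is the union of a chain of subsets of smaller cardinality. -/
theorem exists_chain_of_smaller_sets (α : Type u) [Infinite α] :
    ∃ f : α → Set α, (∀ i j, f i ⊆ f j ∨ f j ⊆ f i) ∧ (∀ i, #(f i) < #α) ∧ ∀ i, i ∈ f i := by
  obtain ⟨_, _, h⟩ := exists_ord_eq_type_lt α
  refine ⟨fun i => Iic i, fun i j => ?_, fun i => ?_, fun i => self_mem_Iic⟩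
  · exact (le_total i j).imp Iic_subset_Iic.2 Iic_subset_Iic.2
  · change #(Iic i) < #α
    rw [← Iio_insert]
    exact mk_insert_lt (aleph0_le_mk α) _ (Cardinal.mk_Iio_lt i h)

/-! ### Hulls generated by finite subsets. -/

section FinHull

variable {α : Type u}

/-- The union of the values of `Y` at the finite subsets of `z`. -/
def finHull (Y : Finset α → Set α) (z : Set α) : Set α :=
  ⋃ e ∈ {e : Finset α | (e : Set α) ⊆ z}, Y e

theorem subset_finHull_of_subset {Y : Finset α → Set α} {z : Set α} {e : Finset α}
    (he : (e : Set α) ⊆ z) : Y e ⊆ finHull Y z :=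
  subset_biUnion_of_mem (u := Y) (show e ∈ {e : Finset α | (e : Set α) ⊆ z} from he)

theorem mem_finHull {Y : Finset α → Set α} {z : Set α} {a : α} :
    a ∈ finHull Y z ↔ ∃ e : Finset α, (e : Set α) ⊆ z ∧ a ∈ Y e := by
  simp [finHull]

theorem finHull_mono {Y : Finset α → Set α} {z z' : Set α} (h : z ⊆ z') :
    finHull Y z ⊆ finHull Y z' :=
  biUnion_subset_biUnion_left fun _ he => Subset.trans he h

theorem finHull_coe {Y : Finset α → Set α} (hY : Monotone Y) (e : Finset α) :
    finHull Y e = Y e :=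
  Subset.antisymm (iUnion₂_subset fun _ he => hY (Finset.coe_subset.1 he))
    (subset_finHull_of_subset Subset.rfl)

theorem subset_finHull {Y : Finset α → Set α} (hY : ∀ e : Finset α, (e : Set α) ⊆ Y e)
    (z : Set α) : z ⊆ finHull Y z := fun a ha =>
  subset_finHull_of_subset (e := {a}) (by simpa using ha) (hY {a} (by simp))

theorem mk_finHull_lt {K : Cardinal.{u}} (hK : K.IsRegular) {Y : Finset α → Set α} {z : Set α}
    (hz : #z < K) (hY : ∀ e : Finset α, (e : Set α) ⊆ z → #(Y e) < K) : #(finHull Y z) < K :=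
  mk_biUnion_lt hK (mk_finset_subsets_lt hK.aleph0_le hz) hY

theorem exists_finset_of_subset_finHull {Y : Finset α → Set α} (hY : Monotone Y) {z : Set α}
    {e : Finset α} (he : (e : Set α) ⊆ finHull Y z) :
    ∃ e' : Finset α, (e' : Set α) ⊆ z ∧ (e : Set α) ⊆ Y e' := by
  classical
  refine DirectedOn.exists_mem_subset_of_finset_subset_biUnion (f := Y)
    (c := {e : Finset α | (e : Set α) ⊆ z}) ⟨∅, by simp⟩ ?_ he
  intro a ha b hb
  refine ⟨a ∪ b, ?_, hY Finset.subset_union_left, hY Finset.subset_union_right⟩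
  rw [mem_ofPred_eq, Finset.coe_union]
  exact union_subset ha hb

end FinHull

/-! ### Every club in P_κ A contains the hulls of a monotone finitary operator. -/

section Clubs

variable {κ : Cardinal.{u}} {A : Set Ordinal.{u}} {C : Set (Set Ordinal.{u})}

/-- Recursion along proper inclusion of finite sets: Y e is chosen in C above e and the finitely
many values at proper subsets of e. -/
theorem IsClubPk.exists_monotone (hC : IsClubPk κ A C) (hreg : κ.IsRegular) :
    ∃ Y : Finset Ordinal.{u} → Set Ordinal.{u}, Monotone Y ∧
      (∀ e : Finset Ordinal.{u}, (e : Set Ordinal.{u}) ⊆ Y e) ∧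
      ∀ e : Finset Ordinal.{u}, (e : Set Ordinal.{u}) ⊆ A → Y e ∈ C := by
  have hc : ∀ x : Set Ordinal.{u}, ∃ y, x ⊆ y ∧ (x ∈ Pk κ A → y ∈ C) := by
    intro x
    by_cases h : x ∈ Pk κ A
    · obtain ⟨y, hy, hxy⟩ := hC.unbounded x h
      exact ⟨y, hxy, fun _ => hy⟩
    · exact ⟨x, Subset.rfl, fun h' => absurd h' h⟩
  choose c hc hcC using hc
  let Y : Finset Ordinal.{u} → Set Ordinal.{u} :=
    wellFounded_lt.fix fun e Y => c (↑e ∪ ⋃ (e' : Finset Ordinal.{u}) (h : e' < e), Y e' h)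
  have hY : ∀ e, Y e = c (↑e ∪ ⋃ e' ∈ Iio e, Y e') := fun e => WellFounded.fix_eq _ _ e
  refine ⟨Y, fun e e' h => ?_, fun e => ?_, fun e => ?_⟩
  · rcases h.eq_or_lt with rfl | h
    · exact Subset.rfl
    · rw [hY e']
      exact (subset_biUnion_of_mem (u := Y) (show e ∈ Iio e' from h)).trans
        (subset_union_right.trans (hc _))
  · rw [hY e]
    exact subset_union_left.trans (hc _)
  · induction e using WellFoundedLT.induction with
    | ind e ih =>
      intro he
      have hsub : ∀ e' ∈ Iio e, Y e' ∈ C := fun e' h =>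
        ih e' h ((Finset.coe_subset.2 h.le).trans he)
      rw [hY e]
      refine hcC _ ⟨union_subset he (iUnion₂_subset fun e' h => (hC.subset (hsub e' h)).1), ?_⟩
      have hK : (Cardinal.lift.{u + 1} κ).IsRegular := hreg.lift
      exact mk_union_lt hK.aleph0_le (mk_lt_of_finite hK.aleph0_le e.finite_toSet)
        (mk_biUnion_lt hK (mk_lt_of_finite hK.aleph0_le (finite_Iio e))
          fun e' h => (hC.subset (hsub e' h)).2)

/-- Closure of C is given for chains, whereas the hull is a directed union. Induction on |z| bridges
this: an infinite z is the union of a chain of smaller subsets, whose hulls form a chain with union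
the hull of z. -/
theorem IsClubPk.finHull_mem (hC : IsClubPk κ A C) {Y : Finset Ordinal.{u} → Set Ordinal.{u}}
    (hY : Monotone Y) (hYC : ∀ e : Finset Ordinal.{u}, (e : Set Ordinal.{u}) ⊆ A → Y e ∈ C)
    {z : Set Ordinal.{u}} (hz : z ∈ Pk κ A) : finHull Y z ∈ C := by
  obtain ⟨c, hc⟩ : ∃ c, c = #z := ⟨_, rfl⟩
  induction c using WellFoundedLT.induction generalizing z with
  | ind c ih =>
    subst hc
    rcases finite_or_infinite z with hf | hi
    · obtain ⟨e, rfl⟩ := (toFinite z).exists_finset_coe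
      rw [finHull_coe hY]
      exact hYC e hz.1
    · obtain ⟨f, hchain, hcard, hmem⟩ := exists_chain_of_smaller_sets z
      let F : z → Set Ordinal.{u} := fun i => Subtype.val '' f i
      have hFz : ∀ i, F i ⊆ z := fun i => Subtype.coe_image_subset _ _
      have hF : ∀ i, #(F i) < #z := fun i => mk_image_le.trans_lt (hcard i)
      have hFchain : ∀ i j, F i ⊆ F j ∨ F j ⊆ F i := fun i j =>
        (hchain i j).imp (fun h => image_mono h) fun h => image_mono h
      have hdir : Directed (· ⊆ ·) F := fun i j => by
        rcases hFchain i j with h | h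
        · exact ⟨j, h, Subset.rfl⟩
        · exact ⟨i, Subset.rfl, h⟩
      have heq : finHull Y z = ⋃₀ range fun i => finHull Y (F i) := by
        refine Subset.antisymm (iUnion₂_subset fun e he => ?_) (sUnion_subset ?_)
        · obtain ⟨i, hi⟩ := hdir.exists_mem_subset_of_finset_subset_biUnion (s := e)
            fun a ha => mem_iUnion.2 ⟨⟨a, he ha⟩, ⟨a, he ha⟩, hmem _, rfl⟩
          exact (subset_finHull_of_subset hi).trans (subset_sUnion_of_mem ⟨i, rfl⟩)
        · rintro _ ⟨i, rfl⟩
          exact finHull_mono (hFz i)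
      rw [heq]
      refine hC.closed _ ?_ (range_nonempty _) ?_ (mk_range_le.trans_lt hz.2)
      · rintro _ ⟨i, rfl⟩
        exact ih _ (hF i) ⟨(hFz i).trans hz.1, (hF i).trans hz.2⟩ rfl
      · rintro _ ⟨i, rfl⟩ _ ⟨j, rfl⟩ -
        exact (hFchain i j).imp finHull_mono finHull_mono

end Clubs

/-! ### The hull W, with its traces on κ coded by the listing. -/

section Hull

variable {κ l : Cardinal.{u}} {π : Ordinal.{u} → Ordinal.{u} → Ordinal.{u}}
  {g : Ordinal.{u} → Ordinal.{u} → Set Ordinal.{u}}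

/-- A finitary hull operator above `Y` such that any `y` in `clubD` extending `W e` already
contains the trace on `κ` of `W (insert γ e)` for `γ ∈ y ∩ κ⁺`. -/
theorem exists_hull_operator (hreg : κ.IsRegular) (hκ : ℵ₀ < κ) (hl : succ κ ≤ l)
    (hg : IsListing κ l g) {Y : Finset Ordinal.{u} → Set Ordinal.{u}} (hY : Monotone Y)
    (hYs : ∀ e : Finset Ordinal.{u}, (e : Set Ordinal.{u}) ⊆ Y e)
    (hYP : ∀ e : Finset Ordinal.{u}, (e : Set Ordinal.{u}) ⊆ Iio l.ord → Y e ∈ Pk κ (Iio l.ord)) :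
    ∃ W : Finset Ordinal.{u} → Set Ordinal.{u}, Monotone W ∧ (∀ e, Y e ⊆ W e) ∧
      (∀ e : Finset Ordinal.{u}, (e : Set Ordinal.{u}) ⊆ Iio l.ord → W e ∈ Pk κ (Iio l.ord)) ∧
      (∀ e e' : Finset Ordinal.{u}, (e' : Set Ordinal.{u}) ⊆ W e → W e' ⊆ W e) ∧
      ∀ e : Finset Ordinal.{u}, (e : Set Ordinal.{u}) ⊆ Iio l.ord → ∀ y ∈ clubD κ l π g,
        W e ⊆ y → ∀ γ ∈ y, γ < (succ κ).ord → W (insert γ e) ∩ Iio κ.ord ⊆ y := by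
  have hK : (Cardinal.lift.{u + 1} κ).IsRegular := hreg.lift
  have hMl : (succ κ).ord ≤ l.ord := ord_le_ord.2 hl
  obtain ⟨Z, hZ0, hP, hQ⟩ := exists_seq_of_step
    (P := fun Y : Finset Ordinal.{u} → Set Ordinal.{u} => Monotone Y ∧
      (∀ e : Finset Ordinal.{u}, (e : Set Ordinal.{u}) ⊆ Y e) ∧
      ∀ e : Finset Ordinal.{u}, (e : Set Ordinal.{u}) ⊆ Iio l.ord → Y e ∈ Pk κ (Iio l.ord))
    (Q := fun Y Y' =>
      (∀ e e' : Finset Ordinal.{u}, (e' : Set Ordinal.{u}) ⊆ Y e → Y e' ⊆ Y' e) ∧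
      ∀ e : Finset Ordinal.{u}, (e : Set Ordinal.{u}) ⊆ Iio l.ord → ∃ ξ ∈ Y' e,
        ∀ γ < (succ κ).ord, g ξ γ = Y (insert γ e) ∩ Iio κ.ord) ⟨hY, hYs, hYP⟩ (by
    rintro Y ⟨hY, hYs, hYP⟩
    have hξ : ∀ e : Finset Ordinal.{u}, (e : Set Ordinal.{u}) ⊆ Iio l.ord →
        ∃ ξ < l.ord, ∀ γ < (succ κ).ord, g ξ γ = Y (insert γ e) ∩ Iio κ.ord := by
      intro e he
      refine hg.2 (fun γ => Y (insert γ e) ∩ Iio κ.ord) fun γ hγ => ⟨inter_subset_right, ?_⟩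
      refine (mk_le_mk_of_subset inter_subset_left).trans_lt (hYP _ ?_).2
      rw [Finset.coe_insert]
      exact insert_subset (lt_of_lt_of_le hγ hMl) he
    choose! ξ hξl hξ using hξ
    -- The codes of all subsets of e are included, not just that of e, to keep the operator
    -- monotone.
    refine ⟨fun e => ξ '' Iic e ∪ finHull Y (Y e), ⟨fun e e' h => ?_, fun e => ?_, fun e he => ?_⟩,
      fun e e' h => (subset_finHull_of_subset h).trans subset_union_right,
      fun e he => ⟨ξ e, Or.inl ⟨e, self_mem_Iic, rfl⟩, hξ e he⟩⟩
    · exact union_subset_union (image_mono (Iic_subset_Iic.2 h)) (finHull_mono (hY h))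
    · exact (hYs e).trans ((subset_finHull hYs _).trans subset_union_right)
    · have hP : ∀ e' : Finset Ordinal.{u}, (e' : Set Ordinal.{u}) ⊆ Y e →
          Y e' ∈ Pk κ (Iio l.ord) := fun e' h => hYP e' (h.trans (hYP e he).1)
      refine ⟨union_subset ?_ (iUnion₂_subset fun e' h => (hP e' h).1),
        mk_union_lt hK.aleph0_le
          (mk_lt_of_finite hK.aleph0_le ((finite_Iic e).image _))
          (mk_finHull_lt hK (hYP e he).2 fun e' h => (hP e' h).2)⟩
      rintro _ ⟨e', h, rfl⟩
      exact hξl e' ((Finset.coe_subset.2 h).trans he))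
  have hZm : Monotone Z := monotone_nat_of_le_succ fun n e => (hQ n).1 e e ((hP n).2.1 e)
  refine ⟨fun e => ⋃ n, Z n e, fun e e' h => iUnion_mono fun n => (hP n).1 h,
    fun e => hZ0 ▸ subset_iUnion (fun n => Z n e) 0, fun e he =>
      ⟨iUnion_subset fun n => ((hP n).2.2 e he).1,
        mk_iUnion_nat_lt hK (aleph0_lt_lift.2 hκ) fun n => ((hP n).2.2 e he).2⟩,
    fun e e' h => iUnion_subset fun m => ?_, fun e he y hy hWy γ hγ hγM => ?_⟩
  · have hdir : Directed (· ⊆ ·) fun n => Z n e :=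
      (show Monotone fun n => Z n e from fun n m h => hZm h e).directed_le
    obtain ⟨n, hn⟩ := hdir.exists_mem_subset_of_finset_subset_biUnion h
    refine (hZm (le_max_right n m) e').trans (Subset.trans ?_
      (subset_iUnion (fun n => Z n e) (max n m + 1)))
    exact (hQ _).1 e e' (hn.trans (hZm (le_max_left n m) e))
  · rintro a ⟨ha, haκ⟩
    obtain ⟨n, hn⟩ := mem_iUnion.1 ha
    obtain ⟨ξ, hξ, hgξ⟩ := (hQ n).2 e he
    refine hy.2.2.2 ξ (hWy (mem_iUnion.2 ⟨n + 1, hξ⟩)) γ hγ hγM ?_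
    rw [hgξ γ hγM]
    exact ⟨hn, haκ⟩

/-- The sets in `P_κ l` closed under a finitary hull operator `W`. -/
def hullClosed (κ l : Cardinal.{u}) (W : Finset Ordinal.{u} → Set Ordinal.{u}) :
    Set (Set Ordinal.{u}) :=
  {x | x ∈ Pk κ (Iio l.ord) ∧ ∀ e : Finset Ordinal.{u}, (e : Set Ordinal.{u}) ⊆ x → W e ⊆ x}

variable {W : Finset Ordinal.{u} → Set Ordinal.{u}}

theorem finHull_mem_hullClosed (hreg : κ.IsRegular) (hW : Monotone W)
    (hWP : ∀ e : Finset Ordinal.{u}, (e : Set Ordinal.{u}) ⊆ Iio l.ord → W e ∈ Pk κ (Iio l.ord))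
    (hWW : ∀ e e' : Finset Ordinal.{u}, (e' : Set Ordinal.{u}) ⊆ W e → W e' ⊆ W e)
    {x : Set Ordinal.{u}} (hx : x ∈ Pk κ (Iio l.ord)) : finHull W x ∈ hullClosed κ l W := by
  refine ⟨⟨iUnion₂_subset fun e he => (hWP e (Subset.trans he hx.1)).1,
    mk_finHull_lt hreg.lift hx.2 fun e he => (hWP e (he.trans hx.1)).2⟩, fun e he => ?_⟩
  obtain ⟨e', he', hee'⟩ := exists_finset_of_subset_finHull hW he
  exact (hWW e' e hee').trans (subset_finHull_of_subset he')

theorem iUnion_mem_hullClosed {ι : Type*} [Nonempty ι] {f : ι → Set Ordinal.{u}}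
    (hf : Directed (· ⊆ ·) f) (h : ∀ i, f i ∈ hullClosed κ l W)
    (hcard : #(⋃ i, f i : Set Ordinal.{u}) < Cardinal.lift.{u + 1} κ) :
    ⋃ i, f i ∈ hullClosed κ l W := by
  refine ⟨⟨iUnion_subset fun i => (h i).1.1, hcard⟩, fun e he => ?_⟩
  obtain ⟨i, hi⟩ := hf.exists_mem_subset_of_finset_subset_biUnion he
  exact ((h i).2 e hi).trans (subset_iUnion f i)

theorem IsClubPk.mem_of_mem_hullClosed {C : Set (Set Ordinal.{u})}
    (hC : IsClubPk κ (Iio l.ord) C) {Y : Finset Ordinal.{u} → Set Ordinal.{u}} (hY : Monotone Y)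
    (hYs : ∀ e : Finset Ordinal.{u}, (e : Set Ordinal.{u}) ⊆ Y e)
    (hYC : ∀ e : Finset Ordinal.{u}, (e : Set Ordinal.{u}) ⊆ Iio l.ord → Y e ∈ C)
    (hYW : ∀ e, Y e ⊆ W e) {x : Set Ordinal.{u}} (hx : x ∈ hullClosed κ l W) : x ∈ C := by
  have h : finHull Y x = x :=
    Subset.antisymm (iUnion₂_subset fun e he => (hYW e).trans (hx.2 e he)) (subset_finHull hYs x)
  rw [← h]
  exact hC.finHull_mem hY hYC hx.1

/-- For finite e ⊆ x ∪ {γ}, the set e ∖ {γ} lies in x, so its hull lies in x ⊆ y. By `hWD` the trace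
of W e is then inside y ∩ κ = x ∩ κ, so adding γ creates no new elements below κ. -/
theorem exists_hullClosed_insert (hreg : κ.IsRegular) (hW : Monotone W)
    (hWs : ∀ e : Finset Ordinal.{u}, (e : Set Ordinal.{u}) ⊆ W e)
    (hWP : ∀ e : Finset Ordinal.{u}, (e : Set Ordinal.{u}) ⊆ Iio l.ord → W e ∈ Pk κ (Iio l.ord))
    (hWW : ∀ e e' : Finset Ordinal.{u}, (e' : Set Ordinal.{u}) ⊆ W e → W e' ⊆ W e)
    (hWD : ∀ e : Finset Ordinal.{u}, (e : Set Ordinal.{u}) ⊆ Iio l.ord → ∀ y ∈ clubD κ l π g,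
        W e ⊆ y → ∀ γ ∈ y, γ < (succ κ).ord → W (insert γ e) ∩ Iio κ.ord ⊆ y)
    {x y : Set Ordinal.{u}} (hx : x ∈ hullClosed κ l W) (hy : y ∈ clubD κ l π g) (hxy : x ⊆ y)
    (hκ : y ∩ Iio κ.ord = x ∩ Iio κ.ord) {γ : Ordinal.{u}} (hγ : γ ∈ y)
    (hγM : γ < (succ κ).ord) :
    ∃ x' ∈ hullClosed κ l W, x ⊆ x' ∧ γ ∈ x' ∧ x' ∩ Iio κ.ord = x ∩ Iio κ.ord := by
  have hs := subset_finHull hWs (insert γ x)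
  refine ⟨finHull W (insert γ x), finHull_mem_hullClosed hreg hW hWP hWW
    ⟨insert_subset (hy.1.1 hγ) hx.1.1, mk_insert_lt (aleph0_le_lift.2 hreg.aleph0_le) _ hx.1.2⟩,
    (subset_insert _ _).trans hs, hs (mem_insert _ _), Subset.antisymm ?_
      (inter_subset_inter_left _ ((subset_insert _ _).trans hs))⟩
  rintro a ⟨ha, haκ⟩
  obtain ⟨e, he, hae⟩ := mem_finHull.1 ha
  have hex : ((e.erase γ : Finset Ordinal.{u}) : Set Ordinal.{u}) ⊆ x := by
    intro b hb
    rw [Finset.coe_erase] at hb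
    exact (he hb.1).resolve_left hb.2
  rw [← hκ]
  refine ⟨hWD _ (hex.trans hx.1.1) y hy ((hx.2 _ hex).trans hxy) γ hγ hγM ⟨?_, haκ⟩, haκ⟩
  exact hW (Finset.insert_erase_subset γ e) hae

end Hull

/-! ### S is stationary. -/

section Stationary

variable {κ l : Cardinal.{u}} {π : Ordinal.{u} → Ordinal.{u} → Ordinal.{u}}
  {g : Ordinal.{u} → Ordinal.{u} → Set Ordinal.{u}}

/-- The supremum of an increasing `ω`-sequence from `y ∈ D` belongs to `y`, provided it is not the
supremum of `y ∩ κ⁺` and countable subsets of `y ∩ κ` are bounded in it. -/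
theorem mem_clubD_of_isLUB {y : Set Ordinal.{u}}
    (hy : y ∈ clubD κ l π g)
    (hyc : ∀ s : ℕ → Ordinal.{u}, (∀ n, s n ∈ y ∩ Iio κ.ord) →
      ∃ η ∈ y ∩ Iio κ.ord, ∀ n, s n < η)
    {α : ℕ → Ordinal.{u}} (hα : StrictMono α) (hαy : ∀ n, α n ∈ y) {β δ : Ordinal.{u}}
    (hβ : β ∈ y) (hβM : β < (succ κ).ord) (hκβ : κ.ord ≤ β) (hδ : IsLUB (range α) δ)
    (hδβ : δ < β) : δ ∈ y := by
  have himg := hy.2.2.1 β hβ hκβ hβM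
  have hle : ∀ n, α n < δ := fun n => (hα n.lt_succ_self).trans_le (hδ.1 ⟨n + 1, rfl⟩)
  -- Pull the sequence back along π_β into y ∩ κ. For η ∈ y ∩ κ above all `s n`, δ is a limit point
  -- of π_β[η], hence in h(π_β(η), β).
  choose s hs hsα using fun n => himg.superset ⟨hαy n, (hle n).trans hδβ⟩
  obtain ⟨η, hη, hsη⟩ := hyc s hs
  have hm := himg.subset ⟨η, hη, rfl⟩
  refine hy.2.1 _ hm.1 β hβ hm.2 hκβ hβM ⟨zero_le.trans_lt (hle 0), fun ε hε => ?_⟩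
  obtain ⟨_, ⟨n, rfl⟩, hn⟩ := (lt_isLUB_iff hδ).1 hε
  exact ⟨α n, ⟨η, hη.2, rfl, s n, hsη n, hsα n⟩, hn, hle n⟩

/-- If a family of sets is unbounded in `P_κ l` and closed under directed unions, some member `x`
has the property that countable subsets of `x ∩ κ` are bounded in `x ∩ κ`. -/
theorem exists_countably_bounded_trace (hreg : κ.IsRegular) (hκ : ℵ_ 2 ≤ κ) (hκl : κ ≤ l)
    {G : Set (Set Ordinal.{u})} (hGP : G ⊆ Pk κ (Iio l.ord))
    (hGu : ∀ x ∈ Pk κ (Iio l.ord), ∃ y ∈ G, x ⊆ y)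
    (hGd : ∀ f : Iio (ℵ₁ : Cardinal.{u}).ord → Set Ordinal.{u}, Directed (· ⊆ ·) f →
      (∀ i, f i ∈ G) → ⋃ i, f i ∈ G) :
    ∃ x ∈ G, ∀ s : ℕ → Ordinal.{u}, (∀ n, s n ∈ x ∩ Iio κ.ord) →
      ∃ η ∈ x ∩ Iio κ.ord, ∀ n, s n < η := by
  have hK : (Cardinal.lift.{u + 1} κ).IsRegular := hreg.lift
  have h1 : (ℵ₁ : Cardinal.{u}) < κ := (aleph_lt_aleph.2 one_lt_two).trans_le hκ
  have h1reg : (ℵ₁ : Cardinal.{u}).IsRegular := isRegular_aleph_one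
  have hH : ∀ U ∈ Pk κ (Iio l.ord), ∃ V ∈ G, U ⊆ V ∧
      ∃ η ∈ V ∩ Iio κ.ord, ∀ ζ ∈ U ∩ Iio κ.ord, ζ < η := by
    intro U hU
    obtain ⟨η, hη, hUη⟩ := exists_bound hreg (s := U ∩ Iio κ.ord) inter_subset_right
      ((mk_le_mk_of_subset inter_subset_left).trans_lt hU.2)
    obtain ⟨V, hV, hUV⟩ := hGu (insert η U)
      ⟨insert_subset (lt_of_lt_of_le hη (ord_le_ord.2 hκl)) hU.1, mk_insert_lt hK.aleph0_le _ hU.2⟩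
    exact ⟨V, hV, (subset_insert _ _).trans hUV, η, ⟨hUV (mem_insert _ _), hη⟩, hUη⟩
  choose! H hHG hUH hHη using hH
  let X : Ordinal.{u} → Set Ordinal.{u} :=
    wellFounded_lt.fix fun i X => H (⋃ (j : Ordinal.{u}) (h : j < i), X j h)
  have hX : ∀ i, X i = H (⋃ j ∈ Iio i, X j) := fun i => WellFounded.fix_eq _ _ i
  have hXG : ∀ i < (ℵ₁ : Cardinal.{u}).ord,
      (⋃ j ∈ Iio i, X j) ∈ Pk κ (Iio l.ord) ∧ X i ∈ G := by
    intro i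
    induction i using WellFoundedLT.induction with
    | ind i ih =>
      intro hi
      have hU : (⋃ j ∈ Iio i, X j) ∈ Pk κ (Iio l.ord) :=
        ⟨iUnion₂_subset fun j hj => (hGP (ih j hj (lt_trans hj hi)).2).1,
          mk_biUnion_lt hK ((mk_Iio_lt_lift hi).trans (Cardinal.lift_lt.2 h1))
            fun j hj => (hGP (ih j hj (lt_trans hj hi)).2).2⟩
      exact ⟨hU, hX i ▸ hHG _ hU⟩
  have hmono : ∀ i j, i < j → j < (ℵ₁ : Cardinal.{u}).ord → X i ⊆ X j := by
    intro i j hij hj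
    rw [hX j]
    exact (subset_biUnion_of_mem (u := X) (show i ∈ Iio j from hij)).trans (hUH _ (hXG j hj).1)
  have hmono' : ∀ i j, i ≤ j → j < (ℵ₁ : Cardinal.{u}).ord → X i ⊆ X j := by
    intro i j hij hj
    rcases hij.eq_or_lt with rfl | h
    · exact Subset.rfl
    · exact hmono i j h hj
  refine ⟨⋃ i : Iio (ℵ₁ : Cardinal.{u}).ord, X i, hGd (fun i => X i) (fun i j => ?_)
    fun i => (hXG i i.2).2, fun s hs => ?_⟩
  · exact ⟨max i j, hmono' _ _ (le_max_left i j) (max i j).2,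
      hmono' _ _ (le_max_right i j) (max i j).2⟩
  · choose i hi using fun n => mem_iUnion.1 (hs n).1
    -- Countably many stages are bounded below ω₁, and stage j adds a bound for everything below κ
    -- collected earlier.
    obtain ⟨j, hj, hij⟩ := exists_bound h1reg (s := range fun n => (i n : Ordinal.{u}))
      (by rintro _ ⟨n, rfl⟩; exact (i n).2)
      ((le_aleph0_iff_set_countable.2 (countable_range _)).trans_lt
        (aleph0_lt_lift.2 aleph0_lt_aleph_one))
    obtain ⟨η, hη, hbound⟩ := hHη _ (hXG j hj).1
    rw [← hX j] at hη
    refine ⟨η, ⟨mem_iUnion.2 ⟨⟨j, hj⟩, hη.1⟩, hη.2⟩, fun n => hbound _ ⟨?_, (hs n).2⟩⟩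
    exact mem_iUnion₂.2 ⟨i n, hij _ ⟨n, rfl⟩, hi n⟩

/-- Members outside `S` have extensions in `D` with the same trace that reach arbitrarily high
below `κ⁺`. -/
theorem exists_mem_clubD_of_notMem_setS (hκ : ℵ₀ ≤ κ) {x : Set Ordinal.{u}}
    (hxP : x ∈ Pk κ (Iio l.ord)) (hx : x ∉ setS κ l π g) {ζ : Ordinal.{u}}
    (hζ : ζ < (succ κ).ord) : ∃ y ∈ clubD κ l π g, x ⊆ y ∧ y ∩ Iio κ.ord = x ∩ Iio κ.ord ∧
      ∃ γ ∈ y, ζ < γ ∧ γ < (succ κ).ord := by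
  have hstat := not_not.1 fun h => hx ⟨hxP, h⟩
  have hlim : IsSuccLimit (succ κ).ord := Cardinal.isSuccLimit_ord (hκ.trans (le_succ κ))
  have hclub : IsClub {a : Iio (succ κ).ord | ζ < a} := by
    refine ⟨fun s hs hne _ a ha => ?_, fun a => ?_⟩
    · obtain ⟨b, hb⟩ := hne
      exact lt_of_lt_of_le (show ζ < (b : Ordinal.{u}) from hs hb) (ha.1 hb)
    · refine ⟨⟨max (succ ζ) a, max_lt (hlim.succ_lt hζ) a.2⟩, ?_, le_max_right (succ ζ) a.1⟩
      exact (lt_succ ζ).trans_le (le_max_left _ _)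
  obtain ⟨a, ⟨y, hy, hxy, htr, ha⟩, hζa⟩ := hstat hclub
  refine ⟨y, hy, hxy, htr, ?_⟩
  rw [mem_ofPred_eq, ha] at hζa
  have hne : (y ∩ Iio (succ κ).ord).Nonempty := by
    rw [nonempty_iff_ne_empty]
    intro h
    rw [h, csSup_empty, Ordinal.bot_eq_zero] at hζa
    exact absurd hζa (not_lt.2 zero_le)
  obtain ⟨γ, hγ, hζγ⟩ := exists_lt_of_lt_csSup hne hζa
  exact ⟨γ, hγ.1, hζγ, hγ.2⟩

/-- Among unboundedly many `γ < κ⁺` there are two, `γ < γ'`, with `γ ∉ π γ' '' a`. -/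
theorem exists_lt_notMem_image (hκ : ℵ₀ ≤ κ) {Γ a : Set Ordinal.{u}}
    (hΓM : Γ ⊆ Iio (succ κ).ord) (hΓ : ∀ ζ < (succ κ).ord, ∃ γ ∈ Γ, ζ < γ)
    (ha : #a < Cardinal.lift.{u + 1} κ) :
    ∃ γ ∈ Γ, ∃ γ' ∈ Γ, γ < γ' ∧ γ ∉ π γ' '' a := by
  have hreg' : (succ κ).IsRegular := isRegular_succ hκ
  have hcard : Cardinal.lift.{u + 1} κ ≤ #Γ := by
    by_contra! h
    obtain ⟨ρ, hρ, hΓρ⟩ := exists_bound hreg' hΓM (h.trans (Cardinal.lift_lt.2 (lt_succ κ)))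
    obtain ⟨γ, hγ, hργ⟩ := hΓ ρ hρ
    exact (hργ.trans (hΓρ γ hγ)).false
  obtain ⟨T, hTΓ, hT⟩ := le_mk_iff_exists_subset.1 hcard
  obtain ⟨ρ, hρ, hTρ⟩ := exists_bound hreg' (hTΓ.trans hΓM)
    (hT ▸ Cardinal.lift_lt.2 (lt_succ κ))
  obtain ⟨γ', hγ', hργ'⟩ := hΓ ρ hρ
  -- T has size κ and lies below γ', while the image of `a` has size less than κ and cannot cover T.
  obtain ⟨γ, hγT, hγ⟩ : ∃ γ ∈ T, γ ∉ π γ' '' a := by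
    by_contra! h
    exact ((mk_le_mk_of_subset h).trans mk_image_le).not_gt (hT ▸ ha)
  exact ⟨γ, hTΓ hγT, γ', hγ', (hTρ γ hγT).trans hργ', hγ⟩

/-- A family of sets closed under unions of `ω`-chains cannot have a member `x` with a countably
bounded trace on `κ` such that all extensions in the family with the same trace can be further
extended, in the family and also in `D`, with the same trace to unboundedly many `γ < κ⁺`. -/
theorem false_of_unbounded_extensions (hκ : ℵ₀ < κ)
    {G : Set (Set Ordinal.{u})}
    (hGω : ∀ f : ℕ → Set Ordinal.{u}, Monotone f → (∀ n, f n ∈ G) → ⋃ n, f n ∈ G)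
    {a x₀ : Set Ordinal.{u}} (hx₀ : x₀ ∈ G) (hx₀a : x₀ ∩ Iio κ.ord = a)
    (hacard : #a < Cardinal.lift.{u + 1} κ)
    (hac : ∀ s : ℕ → Ordinal.{u}, (∀ n, s n ∈ a) → ∃ η ∈ a, ∀ n, s n < η)
    (hGD : ∀ x ∈ G, x ∩ Iio κ.ord = a → ∀ ζ < (succ κ).ord, ∃ y ∈ clubD κ l π g, x ⊆ y ∧
      y ∩ Iio κ.ord = a ∧ ∃ γ ∈ y, ζ < γ ∧ γ < (succ κ).ord)
    (hGG : ∀ x ∈ G, x ∩ Iio κ.ord = a → ∀ ζ < (succ κ).ord, ∃ x' ∈ G, x ⊆ x' ∧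
      x' ∩ Iio κ.ord = a ∧ ∃ γ ∈ x', ζ < γ ∧ γ < (succ κ).ord) : False := by
  have hκM : κ.ord < (succ κ).ord := ord_lt_ord.2 (lt_succ κ)
  have hreg' : (succ κ).IsRegular := isRegular_succ hκ.le
  obtain ⟨γ, ⟨hκγ, hγM, u, huG, hua, hγu⟩, γ', ⟨hκγ', hγM', v, hvG, hva, hγv⟩, hγγ', hnot⟩ :=
    exists_lt_notMem_image (π := π) (Γ := {γ | κ.ord ≤ γ ∧ γ < (succ κ).ord ∧
      ∃ x ∈ G, x ∩ Iio κ.ord = a ∧ γ ∈ x}) hκ.le (fun γ hγ => hγ.2.1) (fun ζ hζ => by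
        obtain ⟨x, hx, -, hxa, γ, hγ, hζγ, hγM⟩ := hGG x₀ hx₀ hx₀a _ (max_lt hζ hκM)
        exact ⟨γ, ⟨(max_lt_iff.1 hζγ).2.le, hγM, x, hx, hxa, hγ⟩, (max_lt_iff.1 hζγ).1⟩) hacard
  -- The state is ((u, v), (α, β)) with α ∈ u and β ∈ v; the two sequences of ordinals interleave,
  -- which forces a common supremum.
  obtain ⟨F, hF0, hP, hQ⟩ := exists_seq_of_step
    (P := fun s : (Set Ordinal.{u} × Set Ordinal.{u}) × (Ordinal.{u} × Ordinal.{u}) =>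
      (s.1.1 ∈ G ∧ s.1.1 ∩ Iio κ.ord = a ∧ s.2.1 ∈ s.1.1) ∧
      (s.1.2 ∈ G ∧ s.1.2 ∩ Iio κ.ord = a ∧ s.2.2 ∈ s.1.2) ∧
      s.2.1 < s.2.2 ∧ s.2.2 < (succ κ).ord)
    (Q := fun s s' => s.1.1 ⊆ s'.1.1 ∧ s.1.2 ⊆ s'.1.2 ∧ s.2.2 < s'.2.1)
    (x := ((u, v), (γ, γ'))) ⟨⟨huG, hua, hγu⟩, ⟨hvG, hva, hγv⟩, hγγ', hγM'⟩ (by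
      rintro ⟨⟨u, v⟩, ⟨α, β⟩⟩ ⟨⟨huG, hua, -⟩, ⟨hvG, hva, -⟩, -, hβM⟩
      obtain ⟨u', hu'G, huu', hu'a, α', hα', hβα', hα'M⟩ := hGG u huG hua β hβM
      obtain ⟨v', hv'G, hvv', hv'a, β', hβ', hαβ', hβ'M⟩ := hGG v hvG hva α' hα'M
      exact ⟨((u', v'), (α', β')), ⟨⟨hu'G, hu'a, hα'⟩, ⟨hv'G, hv'a, hβ'⟩, hαβ', hβ'M⟩,
        huu', hvv', hβα'⟩)
  have hU : Monotone fun n => (F n).1.1 := monotone_nat_of_le_succ fun n => (hQ n).1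
  have hV : Monotone fun n => (F n).1.2 := monotone_nat_of_le_succ fun n => (hQ n).2.1
  have hα : StrictMono fun n => (F n).2.1 :=
    strictMono_nat_of_lt_succ fun n => (hP n).2.2.1.trans (hQ n).2.2
  have hβ : StrictMono fun n => (F n).2.2 :=
    strictMono_nat_of_lt_succ fun n => (hQ n).2.2.trans (hP (n + 1)).2.2.1
  have hUG := hGω _ hU fun n => (hP n).1.1
  have hVG := hGω _ hV fun n => (hP n).2.1.1
  have hUa : (⋃ n, (F n).1.1) ∩ Iio κ.ord = a := by
    rw [iUnion_inter, iUnion_congr fun n => (hP n).1.2.1, iUnion_const]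
  have hVa : (⋃ n, (F n).1.2) ∩ Iio κ.ord = a := by
    rw [iUnion_inter, iUnion_congr fun n => (hP n).2.1.2.1, iUnion_const]
  obtain ⟨ρ, hρM, hρ⟩ := exists_bound hreg' (s := range fun n => (F n).2.2)
    (by rintro _ ⟨n, rfl⟩; exact (hP n).2.2.2)
    ((le_aleph0_iff_set_countable.2 (countable_range _)).trans_lt
      (aleph0_lt_lift.2 (hκ.trans (lt_succ κ))))
  obtain ⟨δ, hδdef⟩ : ∃ δ, δ = sSup (range fun n => (F n).2.2) := ⟨_, rfl⟩
  have hδβ : IsLUB (range fun n => (F n).2.2) δ :=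
    hδdef ▸ isLUB_csSup (range_nonempty _) ⟨ρ, fun b hb => (hρ b hb).le⟩
  have hδα : IsLUB (range fun n => (F n).2.1) δ := by
    refine ⟨?_, fun b hb => hδβ.2 ?_⟩
    · rintro _ ⟨n, rfl⟩
      exact (hP n).2.2.1.le.trans (hδβ.1 ⟨n, rfl⟩)
    · rintro _ ⟨n, rfl⟩
      exact (hQ n).2.2.le.trans (hb ⟨n + 1, rfl⟩)
  have hδM : δ < (succ κ).ord := (hδβ.2 fun b hb => (hρ b hb).le).trans_lt hρM
  have hγ'δ : γ' < δ := by
    have h1 : (F 0).2.2 < (F 1).2.2 := hβ Nat.zero_lt_one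
    rw [hF0] at h1
    exact h1.trans_le (hδβ.1 ⟨1, rfl⟩)
  have hκδ : κ.ord ≤ δ := hκγ'.trans hγ'δ.le
  obtain ⟨y, hyD, hUy, hya, ε, hεy, hδε, hεM⟩ := hGD _ hUG hUa δ hδM
  obtain ⟨y', hyD', hVy, hya', ε', hεy', hδε', hεM'⟩ := hGD _ hVG hVa δ hδM
  have hδy : δ ∈ y := mem_clubD_of_isLUB hyD (hya.symm ▸ hac) hα
    (fun n => hUy (mem_iUnion.2 ⟨n, (hP n).1.2.2⟩)) hεy hεM (hκδ.trans hδε.le) hδα hδε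
  have hδy' : δ ∈ y' := mem_clubD_of_isLUB hyD' (hya'.symm ▸ hac) hβ
    (fun n => hVy (mem_iUnion.2 ⟨n, (hP n).2.1.2.2⟩)) hεy' hεM' (hκδ.trans hδε'.le) hδβ hδε'
  -- Both sides equal π_δ[a]: below δ, the trace on κ determines the set.
  have heq : y ∩ Iio δ = y' ∩ Iio δ := by
    rw [← hyD.2.2.1 δ hδy hκδ hδM, ← hyD'.2.2.1 δ hδy' hκδ hδM, hya, hya']
  have hγy : γ ∈ y := hUy (mem_iUnion.2 ⟨0, by rw [hF0]; exact hγu⟩)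
  have hγy' : γ' ∈ y' := hVy (mem_iUnion.2 ⟨0, by rw [hF0]; exact hγv⟩)
  have hmem : γ ∈ y' := (heq.subset ⟨hγy, hγγ'.trans hγ'δ⟩).1
  have himg := hyD'.2.2.1 γ' hγy' hκγ' hγM'
  rw [hya'] at himg
  exact hnot (himg.superset ⟨hmem, hγγ'⟩)

theorem isStationaryPk_setS (hreg : κ.IsRegular) (hκ : ℵ_ 2 ≤ κ) (hl : succ κ ≤ l)
    (hg : IsListing κ l g) :
    IsStationaryPk κ (Iio l.ord) (setS κ l π g) := by
  refine ⟨fun x hx => hx.1, fun C hC => ?_⟩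
  by_contra hdisj
  have hκ1 : (ℵ₁ : Cardinal.{u}) < κ := (aleph_lt_aleph.2 one_lt_two).trans_le hκ
  have hκ0 : ℵ₀ < κ := aleph0_lt_aleph_one.trans hκ1
  have hK : (Cardinal.lift.{u + 1} κ).IsRegular := hreg.lift
  obtain ⟨Y, hY, hYs, hYC⟩ := hC.exists_monotone hreg
  obtain ⟨W, hW, hYW, hWP, hWW, hWD⟩ := exists_hull_operator (π := π) hreg hκ0 hl hg hY hYs
    fun e he => hC.subset (hYC e he)
  have hWs : ∀ e : Finset Ordinal.{u}, (e : Set Ordinal.{u}) ⊆ W e := fun e =>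
    (hYs e).trans (hYW e)
  have hGS : ∀ x ∈ hullClosed κ l W, x ∉ setS κ l π g := fun x hx hxS =>
    hdisj ⟨x, hxS, hC.mem_of_mem_hullClosed hY hYs hYC hYW hx⟩
  obtain ⟨x₀, hx₀, hx₀c⟩ := exists_countably_bounded_trace hreg hκ ((le_succ κ).trans hl)
    (G := hullClosed κ l W) (fun x hx => hx.1)
    (fun x hx => ⟨_, finHull_mem_hullClosed hreg hW hWP hWW hx, subset_finHull hWs x⟩)
    fun f hf hfG => by
      have : Nonempty (Iio (ℵ₁ : Cardinal.{u}).ord) := ⟨⟨0, isRegular_aleph_one.ord_pos⟩⟩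
      refine iUnion_mem_hullClosed hf hfG ((card_iUnion_lt_iff_forall_of_isRegular hK ?_).2
        fun i => (hfG i).1.2)
      rw [mk_Iio_ord_eq_lift]
      exact Cardinal.lift_lt.2 hκ1
  have hGD : ∀ x ∈ hullClosed κ l W, x ∩ Iio κ.ord = x₀ ∩ Iio κ.ord → ∀ ζ < (succ κ).ord,
      ∃ y ∈ clubD κ l π g, x ⊆ y ∧ y ∩ Iio κ.ord = x₀ ∩ Iio κ.ord ∧
        ∃ γ ∈ y, ζ < γ ∧ γ < (succ κ).ord := fun x hx hxa ζ hζ =>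
    hxa ▸ exists_mem_clubD_of_notMem_setS hκ0.le hx.1 (hGS x hx) hζ
  refine false_of_unbounded_extensions (G := hullClosed κ l W) hκ0 (fun f hf hfG =>
    iUnion_mem_hullClosed hf.directed_le hfG (mk_iUnion_nat_lt hK (aleph0_lt_lift.2 hκ0)
      fun n => (hfG n).1.2)) hx₀ rfl
    ((mk_le_mk_of_subset inter_subset_left).trans_lt hx₀.1.2) hx₀c hGD fun x hx hxa ζ hζ => ?_
  obtain ⟨y, hy, hxy, hya, γ, hγ, hζγ, hγM⟩ := hGD x hx hxa ζ hζ
  obtain ⟨x', hx', hxx', hγx', hx'a⟩ := exists_hullClosed_insert hreg hW hWs hWP hWW hWD hx hy hxy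
    (hya.trans hxa.symm) hγ hγM
  exact ⟨x', hx', hxx', hx'a.trans hxa, γ, hγx', hζγ, hγM⟩

end Stationary

/-! ### Assembly of the theorem. -/

theorem theorem1 (κ l : Cardinal.{u}) (hreg : κ.IsRegular) (hκ : ℵ_ 2 ≤ κ)
    (hl : 2 ^ succ κ ≤ l) :
    ¬ StationaryReflection κ l ∧
    (∃ (π : Ordinal.{u} → Ordinal.{u} → Ordinal.{u})
      (g : Ordinal.{u} → Ordinal.{u} → Set Ordinal.{u}),
      IsBijectionFamily κ π ∧ IsListing κ l g) ∧
    ∀ (π : Ordinal.{u} → Ordinal.{u} → Ordinal.{u})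
      (g : Ordinal.{u} → Ordinal.{u} → Set Ordinal.{u}),
      IsBijectionFamily κ π → IsListing κ l g →
        IsClubPk κ (Iio l.ord) (clubD κ l π g) ∧
        IsNonreflectingStationary κ l (setS κ l π g) := by
  have hκ0 : ℵ₀ < κ :=
    aleph0_lt_aleph_one.trans ((aleph_lt_aleph.2 one_lt_two).trans_le hκ)
  have hl' : succ κ ≤ l := (cantor _).le.trans hl
  have main : ∀ (π : Ordinal.{u} → Ordinal.{u} → Ordinal.{u})
      (g : Ordinal.{u} → Ordinal.{u} → Set Ordinal.{u}),
      IsBijectionFamily κ π → IsListing κ l g →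
        IsClubPk κ (Iio l.ord) (clubD κ l π g) ∧
        IsNonreflectingStationary κ l (setS κ l π g) := fun π g hπ hg =>
    ⟨isClubPk_clubD hreg hκ0 hl' hπ hg, isStationaryPk_setS hreg hκ hl' hg,
      fun ⟨A, hA⟩ => not_reflectsTo_setS hreg hκ0 hl' hπ hg A hA⟩
  obtain ⟨π, hπ⟩ := exists_isBijectionFamily κ
  obtain ⟨g, hg⟩ := exists_isListing hκ0.le hl
  refine ⟨fun h => ?_, ⟨π, g, hπ, hg⟩, main⟩
  obtain ⟨-, hstat, hnon⟩ := main π g hπ hg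
  exact hnon (h _ hstat)
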